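/- Let $d\ge 1$, let $a,\phi:\mathbb{R}^d\to[0,\infty)$ be measurable and even, with $\int_{\mathbb{R}^d} a(x)\,dx<\infty$ and $\int_{\mathbb{R}^d}(1-e^{-\phi(x)})\,dx<\infty$. Let $\Gamma_0=\bigsqcup_{n\ge 0}\Gamma^{(n)}$ be the space of finite subsets $\eta$ of $\mathbb{R}^d$, where $\Gamma^{(n)}$, the set of $n$-point subsets, carries the quotient topology from the $n$-tuples of distinct points, and $\Gamma_0$ carries the disjoint union topology and its Borel $\sigma$-field. Let $\mathcal{M}(\Gamma_0)$ be the Banach space of finite signed measures on $\Gamma_0$ with the total variation norm, and $\mathcal{M}_+(\Gamma_0)$ its cone of positive measures. A $\Gamma_0$-state is a probability measure on $\Gamma_0$. For $\eta\in\Gamma_0$ and measurable $A\subset\Gamma_0$ put $$\Omega(A,\eta)=\sum_{x\in\eta}\int_{\mathbb{R}^d}a(x-y)\exp\Bigl(-\sum_{z\in\eta}\phi(y-z)\Bigr)\mathbb{1}_A\bigl((\eta\setminus\{x\})\cup\{y\}\bigr)\,dy,$$ $$(L^*\mu)(A)=-\int_{\Gamma_0}\Omega(\Gamma_0,\eta)\mathbb{1}_A(\eta)\,\mu(d\eta)+\int_{\Gamma_0}\Omega(A,\eta)\,\mu(d\eta),$$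 with $\mathrm{Dom}(L^*)=\{\mu\in\mathcal{M}(\Gamma_0):\ \Omega(\Gamma_0,\cdot)\mu\in\mathcal{M}(\Gamma_0)\}$. Then $L^*$ is a well-defined operator from $\mathrm{Dom}(L^*)$ to $\mathcal{M}(\Gamma_0)$, and its closure $\overline{L^*}$ generates a stochastic $C_0$-semigroup $(S_\mu(t))_{t\ge 0}$ on $\mathcal{M}(\Gamma_0)$, i.e. a $C_0$-semigroup of bounded operators that leaves $\mathcal{M}_+(\Gamma_0)$ invariant and satisfies $\|S_\mu(t)\mu\|=1$ for all $\mu\in\mathcal{M}_+(\Gamma_0)$ with $\|\mu\|=1$. Consider the Fokker–Planck equation $$\frac{d}{dt}\mu_t=\overline{L^*}\mu_t,\qquad \mu_t|_{t=0}=\mu_0 .$$ (i) For every $\Gamma_0$-state $\mu_0$, the measures $\mu_t=S_\mu(t)\mu_0$, $t\ge0$, are probability measures and form the unique mild solution on $[0,\infty)$, i.e. the unique continuous $\mu:[0,\infty)\to\mathcal{M}(\Gamma_0)$ with $\int_0^t\mu_s\,ds\in\mathrm{Dom}(\overline{L^*})$ and $\mu_t=\mu_0+\overline{L^*}\int_0^t\mu_s\,ds$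 for all $t\ge 0$. (ii) If moreover $\mu_0\in\mathrm{Dom}(\overline{L^*})$, then $\mu_t=S_\mu(t)\mu_0$ is the unique classical solution on $[0,\infty)$, i.e. the unique solution that is continuous on $[0,\infty)$, continuously differentiable on $(0,\infty)$, and lies in $\mathrm{Dom}(\overline{L^*})$ for all $t\geq 0$. (iii) Let $b(\eta)=\delta(|\eta|)$ with $\delta:\{0,1,2,\dots\}\to[0,\infty)$ satisfy $b(\eta)\ge\varepsilon\,\Omega(\Gamma_0,\eta)$ for some $\varepsilon>0$ and all $\eta\in\Gamma_0$. Then each $S_\mu(t)$ leaves $\mathcal{M}_{b,+}(\Gamma_0)=\{\mu\in\mathcal{M}_+(\Gamma_0):\int b\,d\mu<\infty\}$ invariant. If the $\Gamma_0$-state $\mu_0$ belongs to $\mathcal{M}_{b,+}(\Gamma_0)$, then $\mu_t=S_\mu(t)\mu_0$ lies in $\mathrm{Dom}(L^*)$ for all $t\geq 0$ and is a classical solution of the equation with $L^*$ itself in place of $\overline{L^*}$. -/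

import Mathlib

open MeasureTheory Set Filter Topology
open scoped NNReal ENNReal

noncomputable section

namespace Kawasaki

/-! ### The Banach space of signed measures -/

/-- The total variation norm on the space of (finite) signed measures. -/
instance signedMeasureNorm {X : Type*} [MeasurableSpace X] : Norm (SignedMeasure X) where
  norm μ := μ.totalVariation.real univ

theorem norm_signedMeasure_def {X : Type*} [MeasurableSpace X] (μ : SignedMeasure X) :
    ‖μ‖ = μ.totalVariation.real univ := rfl

theorem signedMeasure_core {X : Type*} [MeasurableSpace X] :
    NormedSpace.Core ℝ (SignedMeasure X) where
  norm_nonneg μ := measureReal_nonneg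
  norm_smul c μ := by
    simp only [norm_signedMeasure_def, SignedMeasure.totalVariation_eq_variation]
    rw [VectorMeasure.variation_smul]
    simp [measureReal_def]
  norm_triangle μ ν := by
    have hfin : ∀ ρ : SignedMeasure X, ρ.variation univ ≠ ∞ := fun ρ => by
      rw [← SignedMeasure.totalVariation_eq_variation]; exact measure_ne_top _ _
    simp only [norm_signedMeasure_def, SignedMeasure.totalVariation_eq_variation, measureReal_def]
    rw [← ENNReal.toReal_add (hfin μ) (hfin ν)]
    refine ENNReal.toReal_mono (ENNReal.add_ne_top.2 ⟨hfin μ, hfin ν⟩) ?_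
    exact (VectorMeasure.variation_add_le (μ := μ) (ν := ν)) univ
  norm_eq_zero_iff μ := by
    constructor
    · intro h
      ext i hi
      have h1 := SignedMeasure.norm_le_totalVariation μ i
      have h2 : μ.totalVariation.real i ≤ μ.totalVariation.real univ :=
        measureReal_mono (subset_univ i)
      rw [norm_signedMeasure_def] at h
      have h3 : ‖μ i‖ = 0 := le_antisymm (by linarith) (norm_nonneg _)
      simpa using h3
    · rintro rfl
      rw [norm_signedMeasure_def, SignedMeasure.totalVariation_zero]
      simp

instance signedMeasureNormedAddCommGroup {X : Type*} [MeasurableSpace X] :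
    NormedAddCommGroup (SignedMeasure X) :=
  NormedAddCommGroup.ofCore signedMeasure_core

instance signedMeasureNormedSpace {X : Type*} [MeasurableSpace X] :
    NormedSpace ℝ (SignedMeasure X) :=
  NormedSpace.ofCore signedMeasure_core

/-! ### Semigroups and Cauchy problems in a normed space

Linear operators, which need not be everywhere defined, are given by their graphs. -/

/-- A `C₀`-semigroup of bounded operators. -/
structure IsC0Semigroup {V : Type*} [NormedAddCommGroup V] [NormedSpace ℝ V]
    (S : ℝ≥0 → V →L[ℝ] V) : Prop where
  map_zero : S 0 = ContinuousLinearMap.id ℝ V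
  map_add : ∀ s t, S (s + t) = (S s).comp (S t)
  tendsto_zero : ∀ v, Tendsto (fun t => S t v) (𝓝[>] 0) (𝓝 v)

/-- The graph of the generator of a semigroup: the pairs `(v, w)` such that
`(S h v - v) / h → w` as `h → 0+`. -/
def generatorGraph {V : Type*} [NormedAddCommGroup V] [NormedSpace ℝ V]
    (S : ℝ≥0 → V →L[ℝ] V) : Set (V × V) :=
  {p | Tendsto (fun h : ℝ≥0 => (h : ℝ)⁻¹ • (S h p.1 - p.1)) (𝓝[>] 0) (𝓝 p.2)}

/-- `u` is a classical solution on `[0, ∞)` of `u' = A u`, `u 0 = u₀`, where `G` is the graph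
of `A`: it is continuous on `[0, ∞)`, continuously differentiable on `(0, ∞)`, lies in the domain
of `A`, and solves the equation. Only the values of `u` on `[0, ∞)` matter. -/
structure IsClassicalSolution {V : Type*} [NormedAddCommGroup V] [NormedSpace ℝ V]
    (G : Set (V × V)) (u₀ : V) (u : ℝ → V) : Prop where
  initial : u 0 = u₀
  continuousOn : ContinuousOn u (Ici 0)
  differentiableAt : ∀ t, 0 < t → DifferentiableAt ℝ u t
  continuousOn_deriv : ContinuousOn (deriv u) (Ioi 0)
  mem_domain : ∀ t, 0 ≤ t → ∃ w, (u t, w) ∈ G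
  equation : ∀ t, 0 < t → (u t, deriv u t) ∈ G

/-- `u` is a mild solution on `[0, ∞)` of `u' = A u`, `u 0 = u₀`, where `G` is the graph of `A`:
it is continuous, `∫₀ᵗ u` lies in the domain of `A`, and `u t = u₀ + A ∫₀ᵗ u`. -/
structure IsMildSolution {V : Type*} [NormedAddCommGroup V] [NormedSpace ℝ V]
    (G : Set (V × V)) (u₀ : V) (u : ℝ → V) : Prop where
  continuousOn : ContinuousOn u (Ici 0)
  equation : ∀ t, 0 ≤ t → (∫ s in (0 : ℝ)..t, u s, u t - u₀) ∈ G

/-- A stochastic semigroup on the space of signed measures: a `C₀`-semigroup which leaves the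
cone of positive measures invariant and preserves the norm of positive measures of norm one. -/
structure IsStochasticSemigroup {X : Type*} [MeasurableSpace X]
    (S : ℝ≥0 → SignedMeasure X →L[ℝ] SignedMeasure X) : Prop extends IsC0Semigroup S where
  nonneg : ∀ t μ, 0 ≤ μ → 0 ≤ S t μ
  norm_eq_one : ∀ t μ, 0 ≤ μ → ‖μ‖ = 1 → ‖S t μ‖ = 1

/-! ### Finite configurations -/

/-- The space `Γ₀` of finite configurations, i.e. of finite subsets of `ℝᵈ`. -/
@[ext]
structure FinConf (d : ℕ) where
  /-- the set of points of the configuration -/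
  pts : Finset (EuclideanSpace ℝ (Fin d))

/-- The configuration `{x₁, …, xₙ}` of an `n`-tuple of distinct points. -/
def ofTuple {d : ℕ} (n : ℕ)
    (x : {x : Fin n → EuclideanSpace ℝ (Fin d) // Function.Injective x}) : FinConf d :=
  ⟨Finset.univ.map ⟨x.1, x.2⟩⟩

/-- The topology of the disjoint union of the sets of `n`-point configurations, each of which is
the symmetrization of the set of `n`-tuples of distinct points: a set is open iff, for every `n`,
its preimage under `ofTuple n` is open. -/
instance finConfTopology (d : ℕ) : TopologicalSpace (FinConf d) :=
  ⨆ n : ℕ, TopologicalSpace.coinduced (ofTuple n) inferInstance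

/-- The Borel `σ`-field of `Γ₀`. -/
instance finConfMeasurableSpace (d : ℕ) : MeasurableSpace (FinConf d) := borel (FinConf d)

instance finConfBorelSpace (d : ℕ) : BorelSpace (FinConf d) := ⟨rfl⟩

open Classical in
/-- The configuration `η \ x ∪ y`. -/
def jump {d : ℕ} (η : FinConf d) (x y : EuclideanSpace ℝ (Fin d)) : FinConf d :=
  ⟨insert y (η.pts.erase x)⟩

/-! ### The Kawasaki dynamics -/

/-- The energy `E^φ(y, η) = ∑_{z ∈ η} φ(y - z)`. -/
def energy {d : ℕ} (φ : EuclideanSpace ℝ (Fin d) → ℝ) (y : EuclideanSpace ℝ (Fin d))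
    (η : FinConf d) : ℝ :=
  ∑ z ∈ η.pts, φ (y - z)

/-- The jump kernel
`Ω(A, η) = ∑_{x ∈ η} ∫ a(x - y) exp(-E^φ(y, η)) 𝟙_A(η \ x ∪ y) dy`. -/
def Omega {d : ℕ} (a φ : EuclideanSpace ℝ (Fin d) → ℝ) (A : Set (FinConf d))
    (η : FinConf d) : ℝ :=
  ∑ x ∈ η.pts, ∫ y, a (x - y) * Real.exp (-energy φ y η) *
    A.indicator (fun _ => (1 : ℝ)) (jump η x y)

/-- The domain of `L*`: the signed measures `μ` for which `Ω(Γ₀, ·) μ` is a signed measure of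
bounded variation. -/
def domLstar {d : ℕ} (a φ : EuclideanSpace ℝ (Fin d) → ℝ) : Set (SignedMeasure (FinConf d)) :=
  {μ | μ.Integrable (Omega a φ univ)}

/-- The graph of `L*`: the pairs `(μ, ν)` with `μ` in the domain and, for all measurable `A`,
`ν(A) = -∫ Ω(Γ₀, η) 𝟙_A(η) μ(dη) + ∫ Ω(A, η) μ(dη)`. -/
def graphLstar {d : ℕ} (a φ : EuclideanSpace ℝ (Fin d) → ℝ) :
    Set (SignedMeasure (FinConf d) × SignedMeasure (FinConf d)) :=
  {p | p.1 ∈ domLstar a φ ∧ ∀ A, MeasurableSet A →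
    p.2 A = -(∫ᵛ η, Omega a φ univ η * A.indicator (fun _ => (1 : ℝ)) η ∂•p.1) +
      ∫ᵛ η, Omega a φ A η ∂•p.1}

/-- The cone `M_{b,+}(Γ₀)` of positive measures `μ` with `∫ b dμ < ∞`. -/
def coneMb {d : ℕ} (b : FinConf d → ℝ) : Set (SignedMeasure (FinConf d)) :=
  {μ | 0 ≤ μ ∧ μ.Integrable b}

end Kawasaki

end

noncomputable section

namespace Kawasaki

/-! ### Signed measures -/

section SignedMeasures

variable {X : Type*} [MeasurableSpace X]

/-! A jump moves one point and almost surely does not land on another, so the number of points is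
conserved. The space of signed measures is the `ℓ¹`-sum of the spaces of measures carried by the
levels of `n`-point configurations, and `L*` acts in each of them separately. Since `φ ≥ 0`, the
total jump rate on level `n` is at most `n ∫ a`, so the part `L n` of `L*` there is bounded. All
unboundedness comes from the growth of this bound in `n`.

On level `n`, adding a multiple of the identity turns the jump kernel into a kernel of constant mass
`C = n ∫ a`, with operator `K`, and `L n = K - C`. Hence `exp (t L n) = exp (-tC) exp (tK)` is a
contraction, is positive, and preserves mass (`norm_exp_smul_sub_smul_one_le`, `exp_kernel_nonneg`,
`exp_kernel_apply_univ`). Summing over `n` gives the semigroup. Strong continuity follows by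
dominated convergence with dominating sequence `‖π n v‖`.

The operator with components `L n` and maximal domain (`sumGraph`) is the generator
(`generatorGraph_semigroup`), and every solution is determined by its components, which solve
equations with bounded operators. It is also the closure of `L*`, because finite sums of level
components lie in `Dom(L*)` and are dense in its graph (`closure_graphLstar`). Finally, conservation
of the law of `|η|` makes each cone `M_{b,+}` invariant (`semigroup_mem_coneMb`). -/

instance isFiniteMeasure_variation (μ : SignedMeasure X) : IsFiniteMeasure μ.variation := by
  rw [← SignedMeasure.totalVariation_eq_variation]
  unfold SignedMeasure.totalVariation
  infer_instance

theorem norm_eq_variation (μ : SignedMeasure X) : ‖μ‖ = μ.variation.real univ := by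
  rw [norm_signedMeasure_def, SignedMeasure.totalVariation_eq_variation]

theorem norm_apply_le_norm (μ : SignedMeasure X) (A : Set X) : ‖μ A‖ ≤ ‖μ‖ :=
  (SignedMeasure.norm_le_totalVariation μ A).trans (measureReal_mono (subset_univ A))

/-- Evaluation of a signed measure at a set, as a continuous linear functional. -/
def evalCLM (A : Set X) : SignedMeasure X →L[ℝ] ℝ :=
  LinearMap.mkContinuous
    { toFun := fun μ => μ A
      map_add' := fun μ ν => by simp
      map_smul' := fun c μ => by simp } 1
    (fun μ => by simpa using norm_apply_le_norm μ A)

@[simp]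
theorem evalCLM_apply (A : Set X) (μ : SignedMeasure X) : evalCLM A μ = μ A := rfl

/-- For a Hahn set `s`, the total variation is `|μ s| + |μ sᶜ|`, so uniform smallness on sets gives
smallness in norm. -/
theorem norm_le_two_mul_of_forall_apply_le (μ : SignedMeasure X) {C : ℝ}
    (h : ∀ A, MeasurableSet A → ‖μ A‖ ≤ C) : ‖μ‖ ≤ 2 * C := by
  obtain ⟨s, hs, hpos, hneg, h1, h2⟩ := μ.toJordanDecomposition_spec
  have e1 : μ.toJordanDecomposition.posPart.real univ = μ s := by
    rw [h1, measureReal_def, SignedMeasure.toMeasureOfZeroLE_apply _ _ _ MeasurableSet.univ]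
    simp
  have e2 : μ.toJordanDecomposition.negPart.real univ = - μ sᶜ := by
    rw [h2, measureReal_def, SignedMeasure.toMeasureOfLEZero_apply _ _ _ MeasurableSet.univ]
    simp
  rw [norm_signedMeasure_def, SignedMeasure.totalVariation, measureReal_add_apply, e1, e2]
  have := abs_le.1 (h s hs)
  have := abs_le.1 (h sᶜ hs.compl)
  linarith

theorem sum_apply_eq_apply_biUnion (μ : SignedMeasure X) {f : ℕ → Set X}
    (hf : ∀ i, MeasurableSet (f i)) (hd : Pairwise (Function.onFun Disjoint f)) (s : Finset ℕ) :
    ∑ i ∈ s, μ (f i) = μ (⋃ i ∈ s, f i) := by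
  rw [VectorMeasure.of_biUnion_finset (fun i _ j _ hij => hd hij) (fun i _ => hf i)]

instance completeSpace_signedMeasure : CompleteSpace (SignedMeasure X) := by
  refine Metric.complete_of_cauchySeq_tendsto fun u hu => ?_
  have hev : ∀ A, CauchySeq fun n => u n A := fun A =>
    hu.map (evalCLM (X := X) A).uniformContinuous
  choose ν hν using fun A => cauchySeq_tendsto_of_complete (hev A)
  have hunif : ∀ ε > 0, ∃ N, ∀ n ≥ N, ∀ A, ‖ν A - u n A‖ ≤ ε := by
    intro ε hε
    obtain ⟨N, hN⟩ := Metric.cauchySeq_iff.1 hu ε hε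
    refine ⟨N, fun n hn A => ?_⟩
    have h1 : Tendsto (fun m => ‖u m A - u n A‖) atTop (𝓝 ‖ν A - u n A‖) :=
      ((hν A).sub_const _).norm
    refine le_of_tendsto h1 (eventually_atTop.2 ⟨N, fun m hm => ?_⟩)
    have h2 := norm_apply_le_norm (u m - u n) A
    rw [← dist_eq_norm] at h2
    exact (by simpa using h2 : ‖u m A - u n A‖ ≤ _).trans (hN m hm n hn).le
  let ν' : SignedMeasure X :=
    { measureOf' := ν
      empty' := tendsto_nhds_unique (hν ∅) (by simp)
      not_measurable' := fun A hA => tendsto_nhds_unique (hν A) (by simp [hA])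
      m_iUnion' := by
        intro f hf hd
        have hs : ∀ s : Finset ℕ, ∑ i ∈ s, ν (f i) = ν (⋃ i ∈ s, f i) := fun s =>
          tendsto_nhds_unique (tendsto_finsetSum s fun i _ => hν (f i))
            (by simpa only [sum_apply_eq_apply_biUnion _ hf hd] using hν (⋃ i ∈ s, f i))
        -- Countable additivity passes to the setwise limit: the convergence is uniform over all
        -- sets, hence over all finite partial sums, so the two limits may be exchanged.
        refine TendstoUniformlyOnFilter.tendsto_of_eventually_tendsto (p := atTop)
          (F := fun n (s : Finset ℕ) => ∑ i ∈ s, u n (f i)) (L := fun n => u n (⋃ i, f i)) ?_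
          (Eventually.of_forall fun n => (u n).m_iUnion hf hd) (hν _)
        refine (Metric.tendstoUniformly_iff.2 fun ε hε => ?_).tendstoUniformlyOnFilter.mono_right
          le_top
        obtain ⟨N, hN⟩ := hunif (ε / 2) (half_pos hε)
        filter_upwards [eventually_ge_atTop N] with n hn s
        rw [hs, sum_apply_eq_apply_biUnion _ hf hd, dist_eq_norm]
        exact (hN n hn _).trans_lt (half_lt_self hε) }
  refine ⟨ν', Metric.tendsto_atTop.2 fun ε hε => ?_⟩
  obtain ⟨N, hN⟩ := hunif (ε / 3) (by positivity)
  refine ⟨N, fun n hn => ?_⟩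
  rw [dist_comm, dist_eq_norm]
  refine (norm_le_two_mul_of_forall_apply_le (ν' - u n) (C := ε / 3) fun A _ => ?_).trans_lt
    (by linarith)
  exact hN n hn A

/-! ### The cone of positive measures -/

theorem nonneg_iff {μ : SignedMeasure X} : 0 ≤ μ ↔ ∀ A, MeasurableSet A → 0 ≤ μ A := by
  rw [VectorMeasure.le_iff]
  simp

theorem exists_eq_toSignedMeasure {μ : SignedMeasure X} (h : 0 ≤ μ) :
    ∃ m : Measure X, ∃ _ : IsFiniteMeasure m, μ = m.toSignedMeasure := by
  have h' : 0 ≤[univ] μ := by simpa using h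
  exact ⟨μ.toMeasureOfZeroLE univ MeasurableSet.univ h', inferInstance,
    (SignedMeasure.toMeasureOfZeroLE_toSignedMeasure μ h').symm⟩

theorem norm_toSignedMeasure (m : Measure X) [IsFiniteMeasure m] :
    ‖m.toSignedMeasure‖ = m.real univ := by
  rw [norm_eq_variation, Measure.variation_toSignedMeasure]

theorem norm_eq_apply_univ_of_nonneg {μ : SignedMeasure X} (h : 0 ≤ μ) : ‖μ‖ = μ univ := by
  obtain ⟨m, _, rfl⟩ := exists_eq_toSignedMeasure h
  rw [norm_toSignedMeasure, Measure.toSignedMeasure_apply_measurable MeasurableSet.univ]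

theorem nonneg_of_hasSum {ι : Type*} {f : ι → SignedMeasure X} {μ : SignedMeasure X}
    (h : HasSum f μ) (hf : ∀ i, 0 ≤ f i) : 0 ≤ μ :=
  nonneg_iff.2 fun A hA =>
    (h.mapL (evalCLM A)).nonneg fun i => nonneg_iff.1 (hf i) A hA

theorem integral_toSignedMeasure_eq {m : Measure X} [IsFiniteMeasure m] (f : X → ℝ) :
    ∫ᵛ x, f x ∂•m.toSignedMeasure = ∫ x, f x ∂m := by
  rw [← VectorMeasure.integral_toSignedMeasure]
  congr 1
  ext
  simp

theorem integral_nonneg_of_nonneg {μ : SignedMeasure X} (h : 0 ≤ μ) {f : X → ℝ}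
    (hf : ∀ x, 0 ≤ f x) : 0 ≤ ∫ᵛ x, f x ∂•μ := by
  obtain ⟨m, _, rfl⟩ := exists_eq_toSignedMeasure h
  rw [integral_toSignedMeasure_eq]
  exact integral_nonneg hf

/-- Restriction of a signed measure to a set, as a bounded operator. -/
def restrictCLM (A : Set X) : SignedMeasure X →L[ℝ] SignedMeasure X :=
  LinearMap.mkContinuous
    { toFun := fun μ => μ.restrict A
      map_add' := fun μ ν => VectorMeasure.restrict_add μ ν A
      map_smul' := fun c μ => VectorMeasure.restrict_smul c } 1
    (fun μ => by
      rw [one_mul, norm_eq_variation, norm_eq_variation]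
      exact ENNReal.toReal_mono (measure_ne_top _ _)
        (((VectorMeasure.variation_restrict_le).trans Measure.restrict_le_self) univ))

@[simp]
theorem restrictCLM_apply (A : Set X) (μ : SignedMeasure X) :
    restrictCLM A μ = μ.restrict A := rfl

/-! ### Decomposition along a countable measurable partition -/

theorem norm_restrict {A : Set X} (hA : MeasurableSet A) (μ : SignedMeasure X) :
    ‖μ.restrict A‖ = μ.variation.real A := by
  rw [norm_eq_variation, VectorMeasure.variation_restrict hA]
  simp [measureReal_def]

theorem hasSum_measureReal (m : Measure X) [IsFiniteMeasure m] {f : ℕ → Set X}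
    (hf : ∀ i, MeasurableSet (f i)) (hd : Pairwise (Function.onFun Disjoint f)) :
    HasSum (fun i => m.real (f i)) (m.real (⋃ i, f i)) := by
  have h := m.toSignedMeasure.m_iUnion hf hd
  simpa only [Measure.toSignedMeasure_apply_measurable (hf _),
    Measure.toSignedMeasure_apply_measurable (MeasurableSet.iUnion hf)] using h

theorem hasSum_norm_restrict {A : ℕ → Set X} (hA : ∀ n, MeasurableSet (A n))
    (hd : Pairwise (Function.onFun Disjoint A)) (hu : ⋃ n, A n = univ) (μ : SignedMeasure X) :
    HasSum (fun n => ‖μ.restrict (A n)‖) ‖μ‖ := by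
  simp only [norm_restrict (hA _), norm_eq_variation μ, ← hu]
  exact hasSum_measureReal _ hA hd

/-- The series converges absolutely in norm, and evaluating it on sets identifies its sum. -/
theorem hasSum_restrict {A : ℕ → Set X} (hA : ∀ n, MeasurableSet (A n))
    (hd : Pairwise (Function.onFun Disjoint A)) (hu : ⋃ n, A n = univ) (μ : SignedMeasure X) :
    HasSum (fun n => μ.restrict (A n)) μ := by
  have hs : Summable fun n => μ.restrict (A n) :=
    (hasSum_norm_restrict hA hd hu μ).summable.of_norm
  obtain ⟨ν, hν⟩ := hs
  convert! hν
  ext B hB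
  have h1 : HasSum (fun n => μ.restrict (A n) B) (ν B) := hν.mapL (evalCLM B)
  refine HasSum.unique ?_ h1
  have h2 := μ.m_iUnion (f := fun n => B ∩ A n) (fun n => hB.inter (hA n))
    (fun i j hij => (hd hij).mono inter_subset_right inter_subset_right)
  rw [← inter_iUnion, hu, inter_univ] at h2
  simpa only [VectorMeasure.restrict_apply _ (hA _) hB] using h2

/-! ### Kernels acting on signed measures -/

section Kernels

theorem measurable_kernel_real (κ : ProbabilityTheory.Kernel X X) {A : Set X} (hA : MeasurableSet A) :
    Measurable fun x => (κ x).real A :=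
  (κ.measurable_coe hA).ennreal_toReal

theorem integrable_kernel_of_mass {κ : ProbabilityTheory.Kernel X X} {C : ℝ}
    (hκ : ∀ x, (κ x).real univ = C) (μ : SignedMeasure X) :
    μ.Integrable fun x => (κ x).real univ := by
  simp only [hκ]
  exact integrable_const C

theorem mass_nonneg [Nonempty X] {κ : ProbabilityTheory.Kernel X X} {C : ℝ}
    (hκ : ∀ x, (κ x).real univ = C) : 0 ≤ C := by
  rw [← hκ (Classical.arbitrary X)]
  exact measureReal_nonneg

variable (κ : ProbabilityTheory.Kernel X X) [∀ x, IsFiniteMeasure (κ x)]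

theorem integrable_kernel_real {μ : SignedMeasure X}
    (h : μ.Integrable fun x => (κ x).real univ) {A : Set X} (hA : MeasurableSet A) :
    μ.Integrable fun x => (κ x).real A := by
  refine Integrable.mono' h (measurable_kernel_real κ hA).aestronglyMeasurable
    (Eventually.of_forall fun x => ?_)
  rw [Real.norm_of_nonneg measureReal_nonneg]
  exact measureReal_mono (subset_univ A)

open Classical in
/-- The signed measure `A ↦ ∫ κ(x, A) μ(dx)`. -/
def kernelMeasure (μ : SignedMeasure X) (h : μ.Integrable fun x => (κ x).real univ) :
    SignedMeasure X where
  measureOf' A := if MeasurableSet A then ∫ᵛ x, (κ x).real A ∂•μ else 0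
  empty' := by simp
  not_measurable' A hA := by simp [hA]
  m_iUnion' f hf hd := by
    simp only [hf, if_true, MeasurableSet.iUnion hf]
    have hs : ∀ x, HasSum (fun n => (κ x).real (f n)) ((κ x).real (⋃ n, f n)) := fun x =>
      hasSum_measureReal (κ x) hf hd
    refine VectorMeasure.hasSum_integral_of_dominated_convergence
      (fun n x => (κ x).real (f n))
      (fun n => (measurable_kernel_real κ (hf n)).aestronglyMeasurable)
      (fun n => Eventually.of_forall fun x => ?_) (Eventually.of_forall fun x => (hs x).summable) ?_
      (Eventually.of_forall hs)
    · rw [Real.norm_of_nonneg measureReal_nonneg]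
    · simp only [(hs _).tsum_eq]
      exact integrable_kernel_real κ h (MeasurableSet.iUnion hf)

theorem kernelMeasure_apply {μ : SignedMeasure X} (h : μ.Integrable fun x => (κ x).real univ)
    {A : Set X} (hA : MeasurableSet A) :
    kernelMeasure κ μ h A = ∫ᵛ x, (κ x).real A ∂•μ := if_pos hA

variable {κ} {C : ℝ}

/-- The variation of the image is dominated by the image of the variation, whose mass is `C |μ|(X)`.
The sign of `C` is read off at a point, so the empty space is treated apart. -/
theorem norm_kernelMeasure_le (hκ : ∀ x, (κ x).real univ = C) (μ : SignedMeasure X) :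
    ‖kernelMeasure κ μ (integrable_kernel_of_mass hκ μ)‖ ≤ C * ‖μ‖ := by
  rcases isEmpty_or_nonempty X with hX | hX
  · have : ∀ ν : SignedMeasure X, ν = 0 := fun ν => VectorMeasure.eq_zero_of_isEmpty ν
    rw [this μ, this (kernelMeasure _ _ _)]
    simp
  have hmass := mass_nonneg hκ
  have hle : (kernelMeasure κ μ (integrable_kernel_of_mass hκ μ)).variation
      ≤ μ.variation.bind κ := by
    refine VectorMeasure.variation_le_of_forall_enorm_le fun A hA => ?_
    rw [kernelMeasure_apply _ _ hA, Measure.bind_apply hA κ.aemeasurable]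
    refine VectorMeasure.enorm_integral_le_lintegral_enorm_transpose.trans ?_
    rw [VectorMeasure.variation_transpose_lsmul]
    refine lintegral_mono fun x => ?_
    rw [Real.enorm_of_nonneg measureReal_nonneg, ofReal_measureReal]
  have huniv : μ.variation.bind κ univ = ENNReal.ofReal C * μ.variation univ := by
    rw [Measure.bind_apply MeasurableSet.univ κ.aemeasurable]
    have h : ∀ x, κ x univ = ENNReal.ofReal C := fun x => by rw [← hκ x, ofReal_measureReal]
    simp only [h, lintegral_const]
  rw [norm_eq_variation, norm_eq_variation, measureReal_def, measureReal_def]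
  calc _ ≤ (ENNReal.ofReal C * μ.variation univ).toReal :=
        ENNReal.toReal_mono (ENNReal.mul_ne_top ENNReal.ofReal_ne_top (measure_ne_top _ _))
          (huniv ▸ hle univ)
    _ = _ := by rw [ENNReal.toReal_mul, ENNReal.toReal_ofReal hmass]

/-- The bounded operator on signed measures given by a kernel of constant mass. -/
def kernelCLM (hκ : ∀ x, (κ x).real univ = C) : SignedMeasure X →L[ℝ] SignedMeasure X :=
  LinearMap.mkContinuous
    { toFun := fun μ => kernelMeasure κ μ (integrable_kernel_of_mass hκ μ)
      map_add' := fun μ ν => by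
        ext A hA
        have hi := fun ρ : SignedMeasure X =>
          integrable_kernel_real κ (integrable_kernel_of_mass hκ ρ) hA
        rw [add_apply]
        simp only [kernelMeasure_apply _ _ hA]
        exact VectorMeasure.integral_add_vectorMeasure (hi μ) (hi ν)
      map_smul' := fun c μ => by
        ext A hA
        rw [RingHom.id_apply, smul_apply]
        simp only [kernelMeasure_apply _ _ hA]
        exact VectorMeasure.integral_smul_vectorMeasure _ c } C
    (norm_kernelMeasure_le hκ)

theorem kernelCLM_apply (hκ : ∀ x, (κ x).real univ = C) (μ : SignedMeasure X) {A : Set X} (hA : MeasurableSet A) :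
    kernelCLM hκ μ A = ∫ᵛ x, (κ x).real A ∂•μ :=
  kernelMeasure_apply κ (integrable_kernel_of_mass hκ μ) hA

theorem norm_kernelCLM_le (hκ : ∀ x, (κ x).real univ = C) (hC : 0 ≤ C) : ‖kernelCLM hκ‖ ≤ C :=
  LinearMap.mkContinuous_norm_le _ hC _

theorem kernelCLM_nonneg (hκ : ∀ x, (κ x).real univ = C) {μ : SignedMeasure X} (h : 0 ≤ μ) : 0 ≤ kernelCLM hκ μ :=
  nonneg_iff.2 fun A hA => by
    rw [kernelCLM_apply hκ μ hA]
    exact integral_nonneg_of_nonneg h fun x => measureReal_nonneg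

theorem kernelCLM_apply_univ (hκ : ∀ x, (κ x).real univ = C) (μ : SignedMeasure X) :
    kernelCLM hκ μ univ = C * μ univ := by
  rw [kernelCLM_apply hκ μ MeasurableSet.univ]
  simp only [hκ]
  rw [VectorMeasure.integral_const]
  simp

end Kernels

end SignedMeasures

/-! ### Exponentials of bounded operators -/

section Exponential

variable {V : Type*} [NormedAddCommGroup V] [NormedSpace ℝ V]

open NormedSpace

theorem exp_smul_apply_comm (L : V →L[ℝ] V) (v : V) (t : ℝ) :
    exp (t • L) (L v) = L (exp (t • L) v) := by
  have h : Commute (exp (t • L)) L := ((Commute.refl L).smul_left t).exp_left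
  exact congrArg (fun T : V →L[ℝ] V => T v) h.eq

variable [CompleteSpace V]

theorem exp_add_smul (L : V →L[ℝ] V) (s t : ℝ) :
    exp ((s + t) • L) = exp (s • L) * exp (t • L) := by
  rw [add_smul]
  refine exp_add_of_commute_of_mem_ball (𝕂 := ℝ)
    (((Commute.refl L).smul_left s).smul_right t) ?_ ?_ <;>
  exact (expSeries_radius_eq_top ℝ (V →L[ℝ] V)).symm ▸ edist_lt_top _ _

theorem exp_smul_sub_smul_one (B : V →L[ℝ] V) (C t : ℝ) :
    exp (t • (B - C • (1 : V →L[ℝ] V))) = Real.exp (-(t * C)) • exp (t • B) := by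
  have h1 : t • (B - C • (1 : V →L[ℝ] V)) = algebraMap ℝ (V →L[ℝ] V) (-(t * C)) + t • B := by
    rw [Algebra.algebraMap_eq_smul_one, smul_sub, smul_smul]
    module
  rw [h1, exp_add_of_commute_of_mem_ball (𝕂 := ℝ) (Algebra.commutes _ _)
    ((expSeries_radius_eq_top ℝ (V →L[ℝ] V)).symm ▸ edist_lt_top _ _)
    ((expSeries_radius_eq_top ℝ (V →L[ℝ] V)).symm ▸ edist_lt_top _ _),
    ← algebraMap_exp_comm, ← Real.exp_eq_exp_ℝ, Algebra.algebraMap_eq_smul_one, smul_mul_assoc,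
    one_mul]

theorem hasDerivAt_exp_smul_apply (L : V →L[ℝ] V) (v : V) (t : ℝ) :
    HasDerivAt (fun s : ℝ => exp (s • L) v) (exp (t • L) (L v)) t :=
  (hasDerivAt_exp_smul_const L t).clm_apply (hasDerivAt_const t v) |>.congr_deriv (by simp)

theorem continuous_exp_smul_apply (L : V →L[ℝ] V) (v : V) :
    Continuous fun s : ℝ => exp (s • L) v :=
  continuous_iff_continuousAt.2 fun t => (hasDerivAt_exp_smul_apply L v t).continuousAt

theorem integral_exp_smul_apply (L : V →L[ℝ] V) (v : V) (t : ℝ) :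
    ∫ s in (0 : ℝ)..t, exp (s • L) (L v) = exp (t • L) v - v := by
  rw [intervalIntegral.integral_eq_sub_of_hasDerivAt
    (fun s _ => hasDerivAt_exp_smul_apply L v s)
    ((continuous_exp_smul_apply L (L v)).intervalIntegrable _ _)]
  simp

/-- A solution of the integral equation `p t = v + ∫₀ᵗ L p` with bounded `L` is given by the
exponential. -/
theorem eq_exp_smul_apply_of_integral_eq (L : V →L[ℝ] V) (v : V) {p : ℝ → V} {T : ℝ}
    (hp : ContinuousOn p (Ici 0)) (h : ∀ t, 0 ≤ t → p t = v + ∫ s in (0 : ℝ)..t, L (p s))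
    (hT : 0 ≤ T) : p T = exp (T • L) v := by
  -- Nothing is known about `p` on the negative axis. Freezing it at its value at `0` makes the
  -- integrand continuous on the line, so the integral is differentiable at the endpoint as well.
  have hq : Continuous fun s : ℝ => L (p (max s 0)) :=
    L.continuous.comp (hp.comp_continuous (by fun_prop) fun s => le_max_right s 0)
  have hpq : ∀ t, 0 ≤ t → p t = v + ∫ s in (0 : ℝ)..t, L (p (max s 0)) := by
    intro t ht
    rw [h t ht]
    congr 1
    refine intervalIntegral.integral_congr fun s hs => ?_
    rw [uIcc_of_le ht] at hs
    simp [hs.1]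
  have key : EqOn p (fun t : ℝ => exp (t • L) v) (Icc 0 T) := by
    refine ODE_solution_unique_of_mem_Icc_right (v := fun _ => L) (s := fun _ => univ)
      (K := ‖L‖₊) (fun t _ => L.lipschitz.lipschitzOnWith) (hp.mono Icc_subset_Ici_self)
      (fun t ht => ?_) (fun _ _ => mem_univ _) (continuous_exp_smul_apply L v).continuousOn
      (fun t _ => ?_) (fun _ _ => mem_univ _) ?_
    · have h1 := ((hq.integral_hasStrictDerivAt 0 t).hasDerivAt.const_add v).hasDerivWithinAt
        (s := Ici t)
      rw [max_eq_left ht.1] at h1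
      exact h1.congr (fun s hs => hpq s (ht.1.trans hs)) (hpq t ht.1)
    · rw [← exp_smul_apply_comm]
      exact (hasDerivAt_exp_smul_apply L v t).hasDerivWithinAt
    · simp [h 0 le_rfl]
  exact key ⟨hT, le_rfl⟩

/-- The factor `exp (-tC)` compensates exactly the power series bound `‖exp (tB)‖ ≤ exp (tC)`. -/
theorem norm_exp_smul_sub_smul_one_le {B : V →L[ℝ] V} {C : ℝ} (hB : ‖B‖ ≤ C) {t : ℝ}
    (ht : 0 ≤ t) : ‖exp (t • (B - C • (1 : V →L[ℝ] V)))‖ ≤ 1 := by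
  have hb : ‖exp (t • B)‖ ≤ Real.exp (t * C) := by
    have h1 := exp_series_hasSum_exp' (𝕂 := ℝ) (t • B)
    have h2 := exp_series_hasSum_exp' (𝕂 := ℝ) (t * C)
    rw [← Real.exp_eq_exp_ℝ] at h2
    rw [← h1.tsum_eq]
    refine ContinuousLinearMap.opNorm_le_bound _ (Real.exp_pos _).le fun v => ?_
    have h3 : HasSum (fun n : ℕ => ((n.factorial : ℝ)⁻¹ • (t • B) ^ n) v) _ :=
      h1.mapL (ContinuousLinearMap.apply ℝ V v)
    rw [h1.tsum_eq]
    refine (congrArg norm h3.tsum_eq.symm).trans_le ?_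
    refine tsum_of_norm_bounded (h2.mul_right ‖v‖) fun n => ?_
    refine (ContinuousLinearMap.le_opNorm _ v).trans ?_
    gcongr
    rw [norm_smul, Real.norm_of_nonneg (by positivity), smul_eq_mul]
    gcongr
    have h4 : ‖t • B‖ ≤ t * C := by
      rw [norm_smul, Real.norm_of_nonneg ht]
      gcongr
    -- The identity has norm at most one, but norm zero if `V` is trivial, so the zeroth power is
    -- bounded separately.
    rcases Nat.eq_zero_or_pos n with rfl | hn
    · rw [pow_zero, pow_zero]
      exact ContinuousLinearMap.norm_id_le
    · exact (norm_pow_le' _ hn).trans (pow_le_pow_left₀ (norm_nonneg _) h4 n)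
  rw [exp_smul_sub_smul_one, norm_smul, Real.norm_of_nonneg (Real.exp_pos _).le]
  calc _ ≤ Real.exp (-(t * C)) * Real.exp (t * C) := by gcongr
    _ = 1 := by rw [← Real.exp_add]; simp

end Exponential

/-! ### Direct sums of bounded generators -/

/-- The projections `π n` decompose the space `V` into an `ℓ¹`-sum of subspaces, and the bounded
operators `L n` act in these subspaces and generate contractions. -/
structure IsGeneratorSum {V : Type*} [NormedAddCommGroup V] [NormedSpace ℝ V]
    (π L : ℕ → V →L[ℝ] V) : Prop where
  proj_ne : ∀ m n v, m ≠ n → π m (π n v) = 0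
  hasSum_proj : ∀ v, HasSum (fun n => π n v) v
  hasSum_norm : ∀ v, HasSum (fun n => ‖π n v‖) ‖v‖
  op_proj : ∀ n v, L n (π n v) = L n v
  proj_op : ∀ n v, π n (L n v) = L n v
  norm_exp_le : ∀ n (t : ℝ), 0 ≤ t → ‖NormedSpace.exp (t • L n)‖ ≤ 1

/-- The graph of the operator acting as `L n` on the range of `π n`, with maximal domain. -/
def sumGraph {V : Type*} [NormedAddCommGroup V] [NormedSpace ℝ V]
    (π L : ℕ → V →L[ℝ] V) : Set (V × V) :=
  {p | ∀ n, L n p.1 = π n p.2}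

namespace IsGeneratorSum

variable {V : Type*} [NormedAddCommGroup V] [NormedSpace ℝ V] {π L : ℕ → V →L[ℝ] V}

open NormedSpace

theorem proj_ext (h : IsGeneratorSum π L) {v w : V} (hvw : ∀ n, π n v = π n w) : v = w :=
  (h.hasSum_proj v).unique (by simpa only [hvw] using h.hasSum_proj w)

theorem proj_self (h : IsGeneratorSum π L) (n : ℕ) (v : V) : π n (π n v) = π n v := by
  have h1 := (h.hasSum_proj v).mapL (π n)
  exact (hasSum_single n fun m hm => h.proj_ne n m v hm.symm).unique h1

theorem commute_proj_exp (h : IsGeneratorSum π L) (n : ℕ) (t : ℝ) (v : V) :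
    π n (exp (t • L n) v) = exp (t • L n) (π n v) := by
  have h1 : Commute (π n) (L n) := by
    ext v
    exact (h.proj_op n v).trans (h.op_proj n v).symm
  exact congrArg (fun T : V →L[ℝ] V => T v) (h1.smul_right t).exp_right.eq

theorem norm_exp_proj_le (h : IsGeneratorSum π L) (t : ℝ≥0) (n : ℕ) (v : V) :
    ‖exp ((t : ℝ) • L n) (π n v)‖ ≤ ‖π n v‖ :=
  (ContinuousLinearMap.le_opNorm _ _).trans
    (mul_le_of_le_one_left (norm_nonneg _) (h.norm_exp_le n t t.2))

/-- Each component imposes an equation between continuous maps, since `L n` and `π n` are bounded.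
-/
theorem isClosed_sumGraph (π L : ℕ → V →L[ℝ] V) : IsClosed (sumGraph π L) := by
  simp only [sumGraph, ofPred_forall]
  exact isClosed_iInter fun n => isClosed_eq (by fun_prop) (by fun_prop)

theorem sumGraph_unique (h : IsGeneratorSum π L) {v w w' : V} (hw : (v, w) ∈ sumGraph π L)
    (hw' : (v, w') ∈ sumGraph π L) : w = w' :=
  h.proj_ext fun n => (hw n).symm.trans (hw' n)

variable [CompleteSpace V]

theorem summable_exp_proj (h : IsGeneratorSum π L) (t : ℝ≥0) (v : V) :
    Summable fun n => exp ((t : ℝ) • L n) (π n v) :=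
  Summable.of_norm_bounded (h.hasSum_norm v).summable fun n => h.norm_exp_proj_le t n v

/-- The semigroup acting as `exp (t L n)` on the range of `π n`. -/
def semigroup (h : IsGeneratorSum π L) (t : ℝ≥0) : V →L[ℝ] V :=
  LinearMap.mkContinuous
    { toFun := fun v => ∑' n, exp ((t : ℝ) • L n) (π n v)
      map_add' := fun v w => by
        simp only [map_add]
        exact (h.summable_exp_proj t v).tsum_add (h.summable_exp_proj t w)
      map_smul' := fun c v => by
        simp only [map_smul, RingHom.id_apply]
        exact (h.summable_exp_proj t v).tsum_const_smul c } 1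
    (fun v => by
      rw [one_mul]
      exact tsum_of_norm_bounded (h.hasSum_norm v) fun n => h.norm_exp_proj_le t n v)

theorem hasSum_semigroup (h : IsGeneratorSum π L) (t : ℝ≥0) (v : V) :
    HasSum (fun n => exp ((t : ℝ) • L n) (π n v)) (h.semigroup t v) :=
  (h.summable_exp_proj t v).hasSum

theorem proj_semigroup (h : IsGeneratorSum π L) (t : ℝ≥0) (n : ℕ) (v : V) :
    π n (h.semigroup t v) = exp ((t : ℝ) • L n) (π n v) := by
  have h1 := (h.hasSum_semigroup t v).mapL (π n)
  have h2 := hasSum_single (f := fun m => π n (exp ((t : ℝ) • L m) (π m v))) n fun m hm => by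
    rw [← h.commute_proj_exp, h.proj_ne n m _ hm.symm]
  rw [h1.unique h2, h.commute_proj_exp, h.proj_self]

theorem continuous_semigroup (h : IsGeneratorSum π L) (v : V) :
    Continuous fun t : ℝ≥0 => h.semigroup t v := by
  refine continuous_iff_continuousAt.2 fun t => ?_
  refine tendsto_tsum_of_dominated_convergence (h.hasSum_norm v).summable (fun n => ?_)
    (Eventually.of_forall fun s n => h.norm_exp_proj_le s n v)
  exact ((continuous_exp_smul_apply (L n) (π n v)).comp NNReal.continuous_coe).tendsto t

theorem continuous_semigroup_toNNReal (h : IsGeneratorSum π L) (v : V) :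
    Continuous fun t : ℝ => h.semigroup t.toNNReal v :=
  (h.continuous_semigroup v).comp continuous_real_toNNReal

theorem semigroup_zero (h : IsGeneratorSum π L) (v : V) : h.semigroup 0 v = v :=
  h.proj_ext fun n => by rw [h.proj_semigroup]; simp

theorem isC0Semigroup (h : IsGeneratorSum π L) : IsC0Semigroup h.semigroup where
  map_zero := by
    ext v
    exact h.semigroup_zero v
  map_add s t := by
    ext v
    refine h.proj_ext fun n => ?_
    rw [ContinuousLinearMap.comp_apply]
    simp only [h.proj_semigroup]
    rw [NNReal.coe_add, exp_add_smul]
    rfl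
  tendsto_zero v := by
    have h1 := (h.continuous_semigroup v).tendsto 0
    rw [h.semigroup_zero] at h1
    exact h1.mono_left nhdsWithin_le_nhds

theorem semigroup_mem_sumGraph (h : IsGeneratorSum π L) {v w : V} (hw : (v, w) ∈ sumGraph π L)
    (t : ℝ≥0) : (h.semigroup t v, h.semigroup t w) ∈ sumGraph π L := fun n => by
  have h1 : L n v = π n w := hw n
  show L n (h.semigroup t v) = π n (h.semigroup t w)
  rw [← h.op_proj, h.proj_semigroup, h.proj_semigroup, ← exp_smul_apply_comm, h.op_proj, h1]

/-- In each component this is the fundamental theorem of calculus for `exp (s L n)`. -/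
theorem integral_semigroup_mem (h : IsGeneratorSum π L) (v : V) {t : ℝ} (ht : 0 ≤ t) :
    (∫ s in (0 : ℝ)..t, h.semigroup s.toNNReal v, h.semigroup t.toNNReal v - v)
      ∈ sumGraph π L := fun n => by
  show L n (∫ s in (0 : ℝ)..t, h.semigroup s.toNNReal v) = π n (h.semigroup t.toNNReal v - v)
  rw [← ContinuousLinearMap.intervalIntegral_comp_comm _
    ((h.continuous_semigroup_toNNReal v).intervalIntegrable _ _), map_sub, h.proj_semigroup,
    Real.coe_toNNReal t ht, ← integral_exp_smul_apply]
  refine intervalIntegral.integral_congr fun s hs => ?_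
  rw [uIcc_of_le ht] at hs
  show L n (h.semigroup s.toNNReal v) = exp (s • L n) (L n (π n v))
  rw [← h.op_proj, h.proj_semigroup, Real.coe_toNNReal s hs.1, exp_smul_apply_comm]

theorem semigroup_sub_eq_integral (h : IsGeneratorSum π L) {v w : V}
    (hw : (v, w) ∈ sumGraph π L) {t : ℝ} (ht : 0 ≤ t) :
    h.semigroup t.toNNReal v - v = ∫ s in (0 : ℝ)..t, h.semigroup s.toNNReal w := by
  refine h.proj_ext fun n => ?_
  have h1 : L n v = π n w := hw n
  rw [← h.integral_semigroup_mem v ht n, ← ContinuousLinearMap.intervalIntegral_comp_comm _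
    ((h.continuous_semigroup_toNNReal w).intervalIntegrable _ _),
    ← ContinuousLinearMap.intervalIntegral_comp_comm _
    ((h.continuous_semigroup_toNNReal v).intervalIntegrable _ _)]
  exact intervalIntegral.integral_congr fun s _ => h.semigroup_mem_sumGraph hw s.toNNReal n

theorem isMildSolution (h : IsGeneratorSum π L) (v : V) :
    IsMildSolution (sumGraph π L) v fun t => h.semigroup t.toNNReal v where
  continuousOn := (h.continuous_semigroup_toNNReal v).continuousOn
  equation _ ht := h.integral_semigroup_mem v ht

/-- The bounded operator `L n` passes under the integral, so `π n u` solves a linear integral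
equation with Lipschitz right-hand side. -/
theorem eq_semigroup_of_isMildSolution (h : IsGeneratorSum π L) {v : V} {u : ℝ → V}
    (hu : IsMildSolution (sumGraph π L) v u) (t : ℝ≥0) : u t = h.semigroup t v := by
  refine h.proj_ext fun n => ?_
  rw [h.proj_semigroup]
  refine eq_exp_smul_apply_of_integral_eq (L n) (π n v) (p := fun s => π n (u s))
    ((π n).continuous.comp_continuousOn hu.continuousOn) (fun s hs => ?_) t.2
  have h1 : L n (∫ r in (0 : ℝ)..s, u r) = π n (u s - v) := hu.equation s hs n
  have h2 : IntervalIntegrable u volume 0 s :=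
    (hu.continuousOn.mono (by rw [uIcc_of_le hs]; exact Icc_subset_Ici_self)).intervalIntegrable
  simp only [h.op_proj]
  rw [ContinuousLinearMap.intervalIntegral_comp_comm _ h2, h1, map_sub, add_sub_cancel]

/-- The orbit of `v` is `v` plus the integral of the continuous orbit of `w`, which is therefore its
derivative. -/
theorem isClassicalSolution (h : IsGeneratorSum π L) {v w : V} (hw : (v, w) ∈ sumGraph π L) :
    IsClassicalSolution (sumGraph π L) v fun t => h.semigroup t.toNNReal v := by
  have hd : ∀ t : ℝ, 0 < t →
      HasDerivAt (fun t => h.semigroup t.toNNReal v) (h.semigroup t.toNNReal w) t := by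
    intro t ht
    have h1 := ((h.continuous_semigroup_toNNReal w).integral_hasStrictDerivAt 0 t).hasDerivAt
    refine (h1.const_add v).congr_of_eventuallyEq ?_
    filter_upwards [lt_mem_nhds ht] with s hs
    rw [← h.semigroup_sub_eq_integral hw hs.le, add_sub_cancel]
  refine ⟨?_, (h.continuous_semigroup_toNNReal v).continuousOn,
    fun t ht => (hd t ht).differentiableAt, ?_,
    fun t _ => ⟨_, h.semigroup_mem_sumGraph hw t.toNNReal⟩, fun t ht => ?_⟩
  · simp [h.semigroup_zero]
  · exact (h.continuous_semigroup_toNNReal w).continuousOn.congr fun t ht => (hd t ht).deriv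
  · rw [(hd t ht).deriv]
    exact h.semigroup_mem_sumGraph hw t.toNNReal

/-- Classical solutions are mild. No bound on `u'` near `0` is needed: `(π n u)' = L n u` extends
continuously to `0` because `L n` is bounded. -/
theorem eq_semigroup_of_isClassicalSolution (h : IsGeneratorSum π L) {v : V} {u : ℝ → V}
    (hu : IsClassicalSolution (sumGraph π L) v u) (t : ℝ≥0) : u t = h.semigroup t v := by
  refine h.eq_semigroup_of_isMildSolution ⟨hu.continuousOn, fun s hs n => ?_⟩ t
  have hc : ContinuousOn u (Icc 0 s) := hu.continuousOn.mono Icc_subset_Ici_self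
  have h2 : IntervalIntegrable u volume 0 s :=
    (uIcc_of_le hs ▸ hc : ContinuousOn u (uIcc 0 s)).intervalIntegrable
  show L n (∫ r in (0 : ℝ)..s, u r) = π n (u s - v)
  rw [← ContinuousLinearMap.intervalIntegral_comp_comm _ h2, map_sub, ← hu.initial]
  refine intervalIntegral.integral_eq_sub_of_hasDerivAt_of_le hs (f := fun r => π n (u r))
    ((π n).continuous.comp_continuousOn hc) (fun r hr => ?_)
    (((L n).continuous.comp_continuousOn (uIcc_of_le hs ▸ hc)).intervalIntegrable)
  rw [show L n (u r) = π n (deriv u r) from hu.equation r hr.1 n]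
  exact (π n).hasFDerivAt.comp_hasDerivAt r (hu.differentiableAt r hr.1).hasDerivAt

theorem tendsto_coe_nhdsGT_zero : Tendsto ((↑) : ℝ≥0 → ℝ) (𝓝[>] 0) (𝓝[>] 0) :=
  tendsto_nhdsWithin_iff.2 ⟨(NNReal.continuous_coe.tendsto' 0 0 rfl).mono_left nhdsWithin_le_nhds,
    eventually_mem_nhdsWithin.mono fun _ ht => NNReal.coe_pos.2 ht⟩

/-- A limit of difference quotients can be read off in each component. Conversely, on the maximal
domain the quotients are averages of the orbit of `w`, which tend to `w`. -/
theorem generatorGraph_semigroup (h : IsGeneratorSum π L) :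
    generatorGraph h.semigroup = sumGraph π L := by
  ext ⟨v, w⟩
  constructor
  · intro hw n
    have h1 := ((π n).continuous.tendsto w).comp hw
    have h2 := ((hasDerivAt_exp_smul_apply (L n) (π n v) 0).tendsto_slope_zero_right).comp
      tendsto_coe_nhdsGT_zero
    have h3 := tendsto_nhds_unique h2 (h1.congr fun t => by
      simp [h.proj_semigroup])
    simpa [h.op_proj] using h3
  · intro hw
    have h1 := (((h.continuous_semigroup_toNNReal w).integral_hasStrictDerivAt 0
      0).hasDerivAt.tendsto_slope_zero_right).comp tendsto_coe_nhdsGT_zero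
    have h2 : Tendsto (fun t : ℝ≥0 => (t : ℝ)⁻¹ • (h.semigroup t v - v)) (𝓝[>] 0)
        (𝓝 (h.semigroup (0 : ℝ).toNNReal w)) := h1.congr fun t => by
      have h3 := h.semigroup_sub_eq_integral hw t.coe_nonneg
      rw [Real.toNNReal_coe] at h3
      simp [h3]
    simpa [h.semigroup_zero, generatorGraph] using h2

end IsGeneratorSum

/-! ### Measurability on the space of finite configurations -/

section Configurations

variable {d : ℕ}

/-- The `n`-tuples of distinct points. -/
abbrev InjTuple (d n : ℕ) : Type :=
  {x : Fin n → EuclideanSpace ℝ (Fin d) // Function.Injective x}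

theorem mem_pts_ofTuple {n : ℕ} {x : InjTuple d n} {p : EuclideanSpace ℝ (Fin d)} :
    p ∈ (ofTuple n x).pts ↔ ∃ i, x.1 i = p := by
  simp [ofTuple]

theorem card_pts_ofTuple {n : ℕ} (x : InjTuple d n) : (ofTuple n x).pts.card = n := by
  simp [ofTuple]

theorem exists_ofTuple_eq (η : FinConf d) : ∃ x, ofTuple η.pts.card x = η := by
  refine ⟨⟨fun i => η.pts.equivFin.symm i,
    Subtype.val_injective.comp η.pts.equivFin.symm.injective⟩, ?_⟩
  ext p
  rw [mem_pts_ofTuple]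
  constructor
  · rintro ⟨i, rfl⟩
    exact (η.pts.equivFin.symm i).2
  · intro hp
    exact ⟨η.pts.equivFin ⟨p, hp⟩, by simp⟩

theorem isOpen_injTuple (d n : ℕ) :
    IsOpen {x : Fin n → EuclideanSpace ℝ (Fin d) | Function.Injective x} := by
  have : {x : Fin n → EuclideanSpace ℝ (Fin d) | Function.Injective x}
      = ⋂ i, ⋂ j, {x | i ≠ j → x i ≠ x j} := by
    ext x
    simp only [mem_ofPred_eq, mem_iInter]
    exact ⟨fun h i j hij => h.ne hij, fun h i j hij => by_contra fun h' => h i j h' hij⟩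
  rw [this]
  refine isOpen_iInter_of_finite fun i => isOpen_iInter_of_finite fun j => ?_
  by_cases hij : i = j
  · simp [hij]
  · simp only [ne_eq, hij, not_false_eq_true, forall_const]
    exact isOpen_ne_fun (continuous_apply i) (continuous_apply j)

instance polishSpace_injTuple (n : ℕ) : PolishSpace (InjTuple d n) :=
  (isOpen_injTuple d n).polishSpace

/-- The configuration of a tuple of distinct points of arbitrary length. -/
def ofSigma (x : Σ n, InjTuple d n) : FinConf d := ofTuple x.1 x.2

theorem isOpen_finConf_iff {U : Set (FinConf d)} :
    IsOpen U ↔ ∀ n, IsOpen (ofTuple n ⁻¹' U) := by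
  rw [isOpen_iSup_iff]
  rfl

theorem isQuotientMap_ofSigma : IsQuotientMap (ofSigma (d := d)) := by
  refine (isQuotientMap_iff _).2 ⟨⟨?_⟩, fun η => ?_⟩
  · refine TopologicalSpace.ext_iff.2 fun U => ?_
    rw [isOpen_finConf_iff, isOpen_coinduced, isOpen_sigma_iff]
    rfl
  · obtain ⟨x, hx⟩ := exists_ofTuple_eq η
    exact ⟨⟨_, x⟩, hx⟩

theorem exists_perm_of_ofTuple_eq {n : ℕ} {x y : InjTuple d n} (h : ofTuple n x = ofTuple n y) :
    ∃ σ : Equiv.Perm (Fin n), y.1 = x.1 ∘ σ := by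
  have h1 : ∀ i, ∃ j, x.1 j = y.1 i := fun i =>
    mem_pts_ofTuple.1 (h ▸ mem_pts_ofTuple.2 ⟨i, rfl⟩)
  choose f hf using h1
  have hinj : Function.Injective f := fun i j hij => y.2 (by rw [← hf, ← hf, hij])
  exact ⟨Equiv.ofBijective f (Finite.injective_iff_bijective.1 hinj), funext fun i => (hf i).symm⟩

/-- The saturation of an open set of tuples is the union of its preimages under the finitely many
permutations of the coordinates. -/
theorem isOpenMap_ofSigma : IsOpenMap (ofSigma (d := d)) := by
  rw [isOpenMap_sigma]
  intro n U hU
  rw [isOpen_finConf_iff]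
  intro m
  by_cases hmn : m = n
  · subst hmn
    have : ofTuple m ⁻¹' ((fun x => ofSigma ⟨m, x⟩) '' U)
        = ⋃ σ : Equiv.Perm (Fin m),
          (fun x : InjTuple d m => (⟨x.1 ∘ σ, x.2.comp σ.injective⟩ : InjTuple d m)) ⁻¹' U := by
      ext x
      simp only [mem_preimage, mem_image, mem_iUnion]
      constructor
      · rintro ⟨y, hy, hxy⟩
        obtain ⟨σ, hσ⟩ := exists_perm_of_ofTuple_eq hxy.symm
        refine ⟨σ, ?_⟩
        convert! hy
        exact hσ.symm
      · rintro ⟨σ, hσ⟩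
        refine ⟨_, hσ, ?_⟩
        ext p
        simp only [ofSigma, mem_pts_ofTuple]
        exact ⟨fun ⟨i, hi⟩ => ⟨σ i, hi⟩, fun ⟨i, hi⟩ => ⟨σ.symm i, by simpa using hi⟩⟩
    rw [this]
    refine isOpen_iUnion fun σ => hU.preimage ?_
    exact Continuous.subtype_mk (continuous_pi fun i =>
      (continuous_apply (σ i)).comp (g := fun y : Fin m → EuclideanSpace ℝ (Fin d) => y (σ i))
        continuous_subtype_val) _
  · convert! isOpen_empty
    ext x
    simp only [mem_preimage, mem_image, mem_empty_iff_false, iff_false, not_exists, not_and]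
    intro y _ hxy
    have := congrArg (fun η : FinConf d => η.pts.card) hxy
    simp only [ofSigma, card_pts_ofTuple] at this
    exact hmn this.symm

instance secondCountableTopology_finConf : SecondCountableTopology (FinConf d) :=
  isQuotientMap_ofSigma.secondCountableTopology isOpenMap_ofSigma

theorem isOpen_exists_mem {U : Set (EuclideanSpace ℝ (Fin d))} (hU : IsOpen U) :
    IsOpen {η : FinConf d | ∃ p ∈ η.pts, p ∈ U} := by
  rw [isOpen_finConf_iff]
  intro n
  have : ofTuple n ⁻¹' {η : FinConf d | ∃ p ∈ η.pts, p ∈ U}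
      = ⋃ i, (fun x : InjTuple d n => x.1 i) ⁻¹' U := by
    ext x
    simp [mem_pts_ofTuple]
  rw [this]
  exact isOpen_iUnion fun i => hU.preimage ((continuous_apply i).comp continuous_subtype_val)

/-- The complement of a finite set is open, so a point of one configuration missing from the other
is detected by an open set. -/
instance t0Space_finConf : T0Space (FinConf d) := by
  refine ⟨fun η ζ h => ?_⟩
  have key : ∀ {η ζ : FinConf d}, Inseparable η ζ → η.pts ⊆ ζ.pts := by
    intro η ζ h p hp
    by_contra hpz
    have hU : IsOpen ((ζ.pts : Set (EuclideanSpace ℝ (Fin d)))ᶜ) :=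
      ζ.pts.finite_toSet.isClosed.isOpen_compl
    obtain ⟨q, hq, hq'⟩ := (h.mem_open_iff (isOpen_exists_mem hU)).1 ⟨p, hp, by simpa using hpz⟩
    exact hq' hq
  exact FinConf.ext (Finset.Subset.antisymm (key h) (key h.symm))

/-- The Borel sets of the quotient are exactly the sets with Borel preimage. This rests on
`Continuous.map_borel_eq` for a continuous surjection from a Polish space onto a second countable T₀
space, and reduces all measurability questions to tuples. -/
theorem measurableSet_finConf_iff {A : Set (FinConf d)} :
    MeasurableSet A ↔ ∀ n, MeasurableSet (ofTuple n ⁻¹' A) := by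
  have hc : ∀ n, Continuous (ofTuple (d := d) n) := fun n =>
    isQuotientMap_ofSigma.continuous.comp continuous_sigmaMk
  refine ⟨fun h n => (hc n).measurable h, fun h => ?_⟩
  have hb : finConfMeasurableSpace d = MeasurableSpace.map ofSigma (borel (Σ n, InjTuple d n)) :=
    (isQuotientMap_ofSigma.continuous.map_borel_eq isQuotientMap_ofSigma.surjective).symm
  rw [hb]
  show MeasurableSet[borel (Σ n, InjTuple d n)] (ofSigma ⁻¹' A)
  borelize (Σ n, InjTuple d n)
  have : ofSigma ⁻¹' A = ⋃ n, Sigma.mk n '' (ofTuple n ⁻¹' A) := by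
    ext ⟨n, x⟩
    simp only [mem_iUnion, mem_image]
    constructor
    · exact fun hx => ⟨n, x, hx, rfl⟩
    · rintro ⟨m, y, hy, heq⟩
      rw [← heq]
      exact hy
  rw [this]
  exact MeasurableSet.iUnion fun n =>
    IsOpenEmbedding.sigmaMk.measurableEmbedding.measurableSet_image.2 (h n)

theorem measurable_ofTuple (n : ℕ) : Measurable (ofTuple (d := d) n) := fun _ hA =>
  measurableSet_finConf_iff.1 hA n

theorem measurable_finConf_iff {Y : Type*} [MeasurableSpace Y] {f : FinConf d → Y} :
    Measurable f ↔ ∀ n, Measurable fun x => f (ofTuple n x) :=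
  ⟨fun h n => h.comp (measurable_ofTuple n),
    fun h _ hB => measurableSet_finConf_iff.2 fun n => h n hB⟩

theorem measurable_card : Measurable fun η : FinConf d => η.pts.card :=
  measurable_finConf_iff.2 fun n => by
    simp only [card_pts_ofTuple]
    exact measurable_const

/-- The set of `n`-point configurations. -/
def level (d n : ℕ) : Set (FinConf d) := {η | η.pts.card = n}

theorem measurableSet_level (n : ℕ) : MeasurableSet (level d n) :=
  measurable_card (measurableSet_singleton n)

end Configurations

/-! ### The jump kernel -/

section JumpKernel

variable {d : ℕ}

theorem energy_ofTuple {n : ℕ} (φ : EuclideanSpace ℝ (Fin d) → ℝ) (y : EuclideanSpace ℝ (Fin d))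
    (x : InjTuple d n) : energy φ y (ofTuple n x) = ∑ j, φ (y - x.1 j) := by
  simp [energy, ofTuple]

theorem mem_pts_jump {η : FinConf d} {x y p : EuclideanSpace ℝ (Fin d)} :
    p ∈ (jump η x y).pts ↔ p = y ∨ p ≠ x ∧ p ∈ η.pts := by
  simp [jump]

theorem measurable_jump_ofTuple {n : ℕ} (i : Fin n) :
    Measurable fun p : InjTuple d n × EuclideanSpace ℝ (Fin d) =>
      jump (ofTuple n p.1) (p.1.1 i) p.2 := by
  obtain ⟨m, rfl⟩ : ∃ m, n = m + 1 := ⟨n - 1, by have := i.pos; omega⟩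
  have hcoord : ∀ j, Measurable fun p : InjTuple d (m + 1) × EuclideanSpace ℝ (Fin d) =>
      p.1.1 j := fun j => (measurable_pi_apply j).comp (measurable_subtype_coe.comp measurable_fst)
  -- On `G` the new point meets no remaining point, and the jump replaces coordinate `i`. Off `G` it
  -- lands on another point, and the jump deletes coordinate `i`, leaving an `m`-tuple.
  let G : Set (InjTuple d (m + 1) × EuclideanSpace ℝ (Fin d)) := {p | ∀ j, j ≠ i → p.1.1 j ≠ p.2}
  have hG : MeasurableSet G := by
    have : G = ⋂ j, ⋂ (_ : j ≠ i), {p | p.1.1 j = p.2}ᶜ := by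
      ext p
      simp [G]
    rw [this]
    exact MeasurableSet.iInter fun j => MeasurableSet.iInter fun _ =>
      (measurableSet_eq_fun (hcoord j) measurable_snd).compl
  refine measurable_of_restrict_of_restrict_compl hG ?_ ?_
  · have hinj : ∀ p : G, Function.Injective (Function.update p.1.1.1 i p.1.2) := by
      intro p j k hjk
      by_cases hj : j = i <;> by_cases hk : k = i
      · rw [hj, hk]
      · subst hj
        rw [Function.update_self, Function.update_of_ne hk] at hjk
        exact absurd hjk.symm (p.2 k hk)
      · subst hk
        rw [Function.update_self, Function.update_of_ne hj] at hjk
        exact absurd hjk (p.2 j hj)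
      · rw [Function.update_of_ne hk, Function.update_of_ne hj] at hjk
        exact p.1.1.2 hjk
    have heq : G.domRestrict (fun p : InjTuple d (m + 1) × EuclideanSpace ℝ (Fin d) =>
        jump (ofTuple (m + 1) p.1) (p.1.1 i) p.2) =
        fun p => ofTuple (m + 1) ⟨Function.update p.1.1.1 i p.1.2, hinj p⟩ := by
      funext p
      ext q
      rw [domRestrict_apply, mem_pts_jump, mem_pts_ofTuple, mem_pts_ofTuple]
      constructor
      · rintro (rfl | ⟨hq, j, rfl⟩)
        · exact ⟨i, Function.update_self ..⟩
        · have hji : j ≠ i := fun h => hq (by rw [h])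
          exact ⟨j, Function.update_of_ne hji ..⟩
      · rintro ⟨j, rfl⟩
        by_cases hj : j = i
        · subst hj
          exact Or.inl (Function.update_self ..)
        · dsimp only
          rw [Function.update_of_ne hj]
          exact Or.inr ⟨fun h => hj (p.1.1.2 h), j, rfl⟩
    rw [heq]
    refine (measurable_ofTuple (m + 1)).comp (Measurable.subtype_mk (measurable_pi_lambda _ ?_))
    intro j
    by_cases hj : j = i
    · subst hj
      simp only [Function.update_self]
      exact measurable_snd.comp measurable_subtype_coe
    · simp only [Function.update_of_ne hj]
      exact (hcoord j).comp measurable_subtype_coe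
  · have heq : Gᶜ.domRestrict (fun p : InjTuple d (m + 1) × EuclideanSpace ℝ (Fin d) =>
        jump (ofTuple (m + 1) p.1) (p.1.1 i) p.2) =
        fun p => ofTuple m ⟨p.1.1.1 ∘ i.succAbove,
          p.1.1.2.comp Fin.succAbove_right_injective⟩ := by
      funext p
      obtain ⟨j, hj, hjp⟩ : ∃ j, j ≠ i ∧ p.1.1.1 j = p.1.2 := by
        by_contra! h
        exact p.2 h
      ext q
      rw [domRestrict_apply, mem_pts_jump, mem_pts_ofTuple, mem_pts_ofTuple]
      have hq : (∃ k, (p.1.1.1 ∘ i.succAbove) k = q) ↔ ∃ k, k ≠ i ∧ p.1.1.1 k = q := by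
        constructor
        · rintro ⟨k, hk⟩
          exact ⟨_, Fin.succAbove_ne i k, hk⟩
        · rintro ⟨k, hk, hkq⟩
          obtain ⟨l, rfl⟩ := Fin.exists_succAbove_eq hk
          exact ⟨l, hkq⟩
      rw [hq]
      constructor
      · rintro (rfl | ⟨hq, k, rfl⟩)
        · exact ⟨j, hj, hjp⟩
        · exact ⟨k, fun h => hq (h ▸ rfl), rfl⟩
      · rintro ⟨k, hk, rfl⟩
        exact Or.inr ⟨fun h => hk (p.1.1.2 h), k, rfl⟩
    rw [heq]
    refine (measurable_ofTuple m).comp (Measurable.subtype_mk (measurable_pi_lambda _ ?_))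
    exact fun j => (hcoord _).comp measurable_subtype_coe

theorem measurable_jump {η : FinConf d} {x : EuclideanSpace ℝ (Fin d)} (hx : x ∈ η.pts) :
    Measurable fun y => jump η x y := by
  obtain ⟨z, hz⟩ := exists_ofTuple_eq η
  rw [← hz, mem_pts_ofTuple] at hx
  obtain ⟨i, rfl⟩ := hx
  have h := (measurable_jump_ofTuple i).comp (measurable_const.prodMk measurable_id :
    Measurable fun y : EuclideanSpace ℝ (Fin d) => (z, y))
  convert! h using 2 with y
  simp [hz]

theorem card_jump {η : FinConf d} {x y : EuclideanSpace ℝ (Fin d)} (hx : x ∈ η.pts)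
    (hy : y ∉ η.pts) : (jump η x y).pts.card = η.pts.card := by
  classical
  have h1 : (jump η x y).pts = insert y (η.pts.erase x) := by
    ext p
    rw [mem_pts_jump]
    simp
  rw [h1, Finset.card_insert_of_notMem fun h => hy (Finset.mem_of_mem_erase h),
    Finset.card_erase_add_one hx]

/-- Density of the jump rate of the point `x` of `η` to `y`. -/
def jumpRate (a φ : EuclideanSpace ℝ (Fin d) → ℝ) (η : FinConf d)
    (x y : EuclideanSpace ℝ (Fin d)) : ℝ :=
  a (x - y) * Real.exp (-energy φ y η)

/-- The measure `A ↦ Ω(A, η)`. -/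
def jumpMeasure (a φ : EuclideanSpace ℝ (Fin d) → ℝ) (η : FinConf d) : Measure (FinConf d) :=
  ∑ x ∈ η.pts, (volume.withDensity fun y => ENNReal.ofReal (jumpRate a φ η x y)).map (jump η x)

variable {a φ : EuclideanSpace ℝ (Fin d) → ℝ}

theorem measurable_energy (hφ : Measurable φ) (η : FinConf d) :
    Measurable fun y => energy φ y η := by
  unfold energy
  exact Finset.measurable_fun_sum _ fun z _ => hφ.comp (measurable_id.sub_const z)

theorem measurable_jumpRate (ha : Measurable a) (hφ : Measurable φ) (η : FinConf d)
    (x : EuclideanSpace ℝ (Fin d)) : Measurable (jumpRate a φ η x) :=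
  (ha.comp (measurable_const.sub measurable_id)).mul (measurable_energy hφ η).neg.exp

theorem jumpRate_nonneg (ha0 : ∀ x, 0 ≤ a x) (η : FinConf d) (x y : EuclideanSpace ℝ (Fin d)) :
    0 ≤ jumpRate a φ η x y :=
  mul_nonneg (ha0 _) (Real.exp_pos _).le

theorem energy_nonneg (hφ0 : ∀ x, 0 ≤ φ x) (y : EuclideanSpace ℝ (Fin d)) (η : FinConf d) :
    0 ≤ energy φ y η :=
  Finset.sum_nonneg fun _ _ => hφ0 _

theorem jumpRate_le (ha0 : ∀ x, 0 ≤ a x) (hφ0 : ∀ x, 0 ≤ φ x) (η : FinConf d)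
    (x y : EuclideanSpace ℝ (Fin d)) : jumpRate a φ η x y ≤ a (x - y) :=
  mul_le_of_le_one_right (ha0 _) (Real.exp_le_one_iff.2 (neg_nonpos.2 (energy_nonneg hφ0 y η)))

theorem integrable_jumpRate (ha : Measurable a) (ha0 : ∀ x, 0 ≤ a x) (hai : Integrable a)
    (hφ : Measurable φ) (hφ0 : ∀ x, 0 ≤ φ x) (η : FinConf d) (x : EuclideanSpace ℝ (Fin d)) :
    Integrable (jumpRate a φ η x) :=
  (hai.comp_sub_left x).mono' (measurable_jumpRate ha hφ η x).aestronglyMeasurable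
    (Eventually.of_forall fun y => by
      rw [Real.norm_of_nonneg (jumpRate_nonneg ha0 η x y)]
      exact jumpRate_le ha0 hφ0 η x y)

theorem jumpMeasure_apply (η : FinConf d)
    {A : Set (FinConf d)} (hA : MeasurableSet A) :
    jumpMeasure a φ η A = ∑ x ∈ η.pts, ∫⁻ y, ENNReal.ofReal (jumpRate a φ η x y) *
      A.indicator 1 (jump η x y) := by
  rw [jumpMeasure, Measure.finsetSum_apply]
  refine Finset.sum_congr rfl fun x hx => ?_
  have hm := (measurable_jump hx) hA
  rw [Measure.map_apply (measurable_jump hx) hA, withDensity_apply _ hm,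
    ← lintegral_indicator hm]
  refine lintegral_congr fun y => ?_
  by_cases hy : jump η x y ∈ A
  · rw [indicator_of_mem (show y ∈ (fun y => jump η x y) ⁻¹' A from hy), indicator_of_mem hy]
    simp
  · rw [indicator_of_notMem (show y ∉ (fun y => jump η x y) ⁻¹' A from hy), indicator_of_notMem hy]
    simp

theorem Omega_eq_sum_integral_jumpRate (A : Set (FinConf d)) (η : FinConf d) :
    Omega a φ A η = ∑ x ∈ η.pts, ∫ y, jumpRate a φ η x y *
      A.indicator (fun _ => (1 : ℝ)) (jump η x y) := rfl

theorem jumpMeasure_apply_eq_ofReal (ha : Measurable a) (ha0 : ∀ x, 0 ≤ a x)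
    (hai : Integrable a) (hφ : Measurable φ) (hφ0 : ∀ x, 0 ≤ φ x) (η : FinConf d)
    {A : Set (FinConf d)} (hA : MeasurableSet A) :
    jumpMeasure a φ η A = ENNReal.ofReal (Omega a φ A η) := by
  have hind : ∀ ζ, 0 ≤ A.indicator (fun _ => (1 : ℝ)) ζ := fun ζ =>
    indicator_nonneg (fun _ _ => zero_le_one) ζ
  rw [jumpMeasure_apply η hA, Omega_eq_sum_integral_jumpRate, ENNReal.ofReal_sum_of_nonneg]
  · refine Finset.sum_congr rfl fun x hx => ?_
    have hmeas : Measurable fun y => A.indicator (fun _ => (1 : ℝ)) (jump η x y) :=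
      (measurable_const.indicator hA).comp (measurable_jump hx)
    rw [ofReal_integral_eq_lintegral_ofReal]
    · refine lintegral_congr fun y => ?_
      rw [ENNReal.ofReal_mul (jumpRate_nonneg ha0 η x y)]
      congr 1
      by_cases hy : jump η x y ∈ A <;> simp [hy]
    · refine (integrable_jumpRate ha ha0 hai hφ hφ0 η x).mono'
        ((measurable_jumpRate ha hφ η x).mul hmeas).aestronglyMeasurable
        (Eventually.of_forall fun y => ?_)
      rw [Real.norm_of_nonneg (mul_nonneg (jumpRate_nonneg ha0 η x y) (hind _))]
      exact mul_le_of_le_one_right (jumpRate_nonneg ha0 η x y)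
        (indicator_le_self' (fun _ _ => zero_le_one) _ |>.trans le_rfl)
    · exact Eventually.of_forall fun y => mul_nonneg (jumpRate_nonneg ha0 η x y) (hind _)
  · exact fun x _ => integral_nonneg fun y => mul_nonneg (jumpRate_nonneg ha0 η x y) (hind _)

theorem Omega_nonneg (ha0 : ∀ x, 0 ≤ a x) (A : Set (FinConf d)) (η : FinConf d) :
    0 ≤ Omega a φ A η :=
  Finset.sum_nonneg fun x _ => integral_nonneg fun y =>
    mul_nonneg (jumpRate_nonneg ha0 η x y) (indicator_nonneg (fun _ _ => zero_le_one) _)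

theorem Omega_univ_le (ha : Measurable a) (ha0 : ∀ x, 0 ≤ a x) (hai : Integrable a)
    (hφ : Measurable φ) (hφ0 : ∀ x, 0 ≤ φ x) (η : FinConf d) :
    Omega a φ univ η ≤ η.pts.card * ∫ x, a x := by
  rw [← nsmul_eq_mul]
  refine Finset.sum_le_card_nsmul _ _ _ fun x _ => ?_
  simp only [indicator_univ, mul_one]
  calc _ ≤ ∫ y, a (x - y) := integral_mono (integrable_jumpRate ha ha0 hai hφ hφ0 η x)
        (hai.comp_sub_left x) (jumpRate_le ha0 hφ0 η x)
    _ = ∫ x, a x := integral_sub_left_eq_self a volume x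

/-- Conservation of the number of points: a jump loses a point only by landing on `η`, and finite
sets are Lebesgue-null in positive dimension. -/
theorem Omega_inter_level (hd : 0 < d) (A : Set (FinConf d)) (n : ℕ) (η : FinConf d) :
    Omega a φ (A ∩ level d n) η = (level d n).indicator (Omega a φ A) η := by
  have : Nonempty (Fin d) := ⟨⟨0, hd⟩⟩
  have hae : ∀ᵐ y : EuclideanSpace ℝ (Fin d), y ∉ η.pts :=
    measure_eq_zero_iff_ae_notMem.1 (η.pts.finite_toSet.measure_zero volume)
  by_cases hη : η ∈ level d n
  · rw [indicator_of_mem hη]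
    refine Finset.sum_congr rfl fun x hx => integral_congr_ae ?_
    filter_upwards [hae] with y hy
    have hj : jump η x y ∈ level d n := (card_jump hx hy).trans hη
    by_cases hA : jump η x y ∈ A
    · simp [hA, hj]
    · simp [hA]
  · rw [indicator_of_notMem hη]
    refine Finset.sum_eq_zero fun x hx => integral_eq_zero_of_ae ?_
    filter_upwards [hae] with y hy
    have hj : jump η x y ∉ level d n := fun h => hη ((card_jump hx hy).symm.trans h)
    simp [hj]

/-- On tuples the sum over points has a fixed index set, and each integrand is jointly measurable in
the tuple and the target point. -/
theorem measurable_jumpMeasure (ha : Measurable a) (hφ : Measurable φ) :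
    Measurable (jumpMeasure a φ) := by
  refine Measure.measurable_of_measurable_coe _ fun A hA => measurable_finConf_iff.2 fun n => ?_
  simp only [jumpMeasure_apply _ hA]
  have heq : ∀ x : InjTuple d n, ∑ p ∈ (ofTuple n x).pts,
      ∫⁻ y, ENNReal.ofReal (jumpRate a φ (ofTuple n x) p y) *
        A.indicator (1 : FinConf d → ℝ≥0∞) (jump (ofTuple n x) p y)
      = ∑ i, ∫⁻ y, ENNReal.ofReal (jumpRate a φ (ofTuple n x) (x.1 i) y) *
        A.indicator (1 : FinConf d → ℝ≥0∞) (jump (ofTuple n x) (x.1 i) y) := fun x => by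
    conv_lhs => rw [show (ofTuple n x).pts = Finset.univ.map ⟨x.1, x.2⟩ from rfl]
    rw [Finset.sum_map]
    rfl
  simp only [heq]
  refine Finset.measurable_fun_sum _ fun i _ => ?_
  have hcoord : ∀ j, Measurable fun p : InjTuple d n × EuclideanSpace ℝ (Fin d) =>
      p.1.1 j := fun j => (measurable_pi_apply j).comp (measurable_subtype_coe.comp measurable_fst)
  refine Measurable.lintegral_prod_right' (f := fun p : InjTuple d n × EuclideanSpace ℝ (Fin d) =>
    ENNReal.ofReal (jumpRate a φ (ofTuple n p.1) (p.1.1 i) p.2) *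
        A.indicator (1 : FinConf d → ℝ≥0∞) (jump (ofTuple n p.1) (p.1.1 i) p.2)) ?_
  refine Measurable.mul (Measurable.ennreal_ofReal ?_)
    ((measurable_one.indicator hA).comp (measurable_jump_ofTuple i))
  simp only [jumpRate, energy_ofTuple]
  exact (ha.comp ((hcoord i).sub measurable_snd)).mul
    (Finset.measurable_fun_sum _ fun j _ => hφ.comp (measurable_snd.sub (hcoord j))).neg.exp

end JumpKernel

/-! ### Semigroups of kernels of constant mass -/

section KernelExp

variable {X : Type*} [MeasurableSpace X] {κ : ProbabilityTheory.Kernel X X}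
  [∀ x, IsFiniteMeasure (κ x)] {C : ℝ}

theorem smul_nonneg_signedMeasure {c : ℝ} (hc : 0 ≤ c) {μ : SignedMeasure X} (h : 0 ≤ μ) :
    0 ≤ c • μ :=
  nonneg_iff.2 fun A hA => by
    rw [smul_apply, smul_eq_mul]
    exact mul_nonneg hc (nonneg_iff.1 h A hA)

theorem kernelCLM_pow_nonneg (hκ : ∀ x, (κ x).real univ = C) {μ : SignedMeasure X} (h : 0 ≤ μ)
    (k : ℕ) : 0 ≤ (kernelCLM hκ ^ k) μ := by
  induction k with
  | zero => simpa using h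
  | succ k ih =>
    rw [pow_succ']
    exact kernelCLM_nonneg hκ ih

theorem kernelCLM_pow_apply_univ (hκ : ∀ x, (κ x).real univ = C) (μ : SignedMeasure X) (k : ℕ) :
    (kernelCLM hκ ^ k) μ univ = C ^ k * μ univ := by
  induction k with
  | zero => simp
  | succ k ih =>
    rw [pow_succ']
    show kernelCLM hκ ((kernelCLM hκ ^ k) μ) univ = _
    rw [kernelCLM_apply_univ, ih, pow_succ']
    ring

theorem hasSum_exp_kernelCLM (hκ : ∀ x, (κ x).real univ = C) (t : ℝ) (μ : SignedMeasure X) :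
    HasSum (fun k : ℕ => ((k.factorial : ℝ)⁻¹ * t ^ k) • (kernelCLM hκ ^ k) μ)
      (NormedSpace.exp (t • kernelCLM hκ) μ) := by
  have h := (NormedSpace.exp_series_hasSum_exp' (𝕂 := ℝ) (t • kernelCLM hκ)).mapL
    (ContinuousLinearMap.apply ℝ (SignedMeasure X) μ)
  convert! h using 2 with k
  rw [ContinuousLinearMap.apply_apply, smul_pow, smul_smul]
  rfl

/-- After the scalar part is split off, what remains is a power series with nonnegative coefficients
in a positive operator. -/
theorem exp_kernel_nonneg (hκ : ∀ x, (κ x).real univ = C) {t : ℝ} (ht : 0 ≤ t)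
    {μ : SignedMeasure X} (h : 0 ≤ μ) :
    0 ≤ NormedSpace.exp (t • (kernelCLM hκ - C • 1)) μ := by
  rw [exp_smul_sub_smul_one]
  refine smul_nonneg_signedMeasure (Real.exp_pos _).le
    (nonneg_of_hasSum (hasSum_exp_kernelCLM hκ t μ) fun k => ?_)
  exact smul_nonneg_signedMeasure (by positivity) (kernelCLM_pow_nonneg hκ h k)

/-- The `k`-th power of the kernel multiplies mass by `C ^ k`, so the series multiplies it by `exp
(tC)`, which the scalar factor cancels. -/
theorem exp_kernel_apply_univ (hκ : ∀ x, (κ x).real univ = C) (t : ℝ) (μ : SignedMeasure X) :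
    NormedSpace.exp (t • (kernelCLM hκ - C • 1)) μ univ = μ univ := by
  have h1 : HasSum (fun k : ℕ => (k.factorial : ℝ)⁻¹ • (t * C) ^ k * μ univ)
      (NormedSpace.exp (t • kernelCLM hκ) μ univ) := by
    convert! (hasSum_exp_kernelCLM hκ t μ).mapL (evalCLM univ) using 2 with k
    rw [map_smul, evalCLM_apply, kernelCLM_pow_apply_univ, mul_pow]
    simp only [smul_eq_mul]
    ring
  have h2 := (NormedSpace.exp_series_hasSum_exp' (𝕂 := ℝ) (t * C)).mul_right (μ univ)
  rw [← Real.exp_eq_exp_ℝ] at h2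
  rw [exp_smul_sub_smul_one]
  show (Real.exp (-(t * C)) • NormedSpace.exp (t • kernelCLM hκ) μ) univ = _
  rw [smul_apply, h1.unique h2, smul_eq_mul, ← mul_assoc, ← Real.exp_add]
  simp

end KernelExp

/-! ### The operators on the sets of `n`-point configurations -/

section Generator

variable {d : ℕ}

theorem iUnion_level : ⋃ n, level d n = univ :=
  eq_univ_of_forall fun η => mem_iUnion.2 ⟨η.pts.card, rfl⟩

theorem pairwise_disjoint_level : Pairwise (Function.onFun Disjoint (level d)) :=
  fun _ _ hmn => disjoint_left.2 fun _ h h' => hmn (h.symm.trans h')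

/-- The kernel `c(x) δ_x`. -/
def diracKernel {X : Type*} [MeasurableSpace X] (c : X → ℝ) (hc : Measurable c) :
    ProbabilityTheory.Kernel X X where
  toFun x := ENNReal.ofReal (c x) • Measure.dirac x
  measurable' := Measure.measurable_of_measurable_coe _ fun A hA => by
    simp only [Measure.smul_apply, Measure.dirac_apply' _ hA, smul_eq_mul]
    exact hc.ennreal_ofReal.mul (measurable_one.indicator hA)

instance isFiniteMeasure_diracKernel {X : Type*} [MeasurableSpace X] (c : X → ℝ)
    (hc : Measurable c) (x : X) : IsFiniteMeasure (diracKernel c hc x) :=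
  Measure.smul_finite (Measure.dirac x) ENNReal.ofReal_ne_top

theorem diracKernel_real {X : Type*} [MeasurableSpace X] {c : X → ℝ} (hc : Measurable c)
    (hc0 : ∀ x, 0 ≤ c x) (x : X) {A : Set X} (hA : MeasurableSet A) :
    (diracKernel c hc x).real A = c x * A.indicator (fun _ => (1 : ℝ)) x := by
  show (ENNReal.ofReal (c x) • Measure.dirac x).real A = _
  rw [measureReal_ennreal_smul_apply, ENNReal.toReal_ofReal (hc0 x), measureReal_def,
    Measure.dirac_apply' _ hA]
  by_cases hx : x ∈ A <;> simp [hx]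

/-- The standing assumptions on the jump kernel and the interaction potential. -/
structure Admissible (a φ : EuclideanSpace ℝ (Fin d) → ℝ) : Prop where
  dim_pos : 0 < d
  measurable_left : Measurable a
  left_nonneg : ∀ x, 0 ≤ a x
  integrable_left : Integrable a
  measurable_right : Measurable φ
  right_nonneg : ∀ x, 0 ≤ φ x

namespace Admissible

variable {a φ : EuclideanSpace ℝ (Fin d) → ℝ}

/-- The kernel `Ω`. -/
def kernel (h : Admissible a φ) : ProbabilityTheory.Kernel (FinConf d) (FinConf d) :=
  ⟨jumpMeasure a φ, measurable_jumpMeasure h.measurable_left h.measurable_right⟩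

theorem kernel_apply (h : Admissible a φ) (η : FinConf d) {A : Set (FinConf d)}
    (hA : MeasurableSet A) : h.kernel η A = ENNReal.ofReal (Omega a φ A η) :=
  jumpMeasure_apply_eq_ofReal h.measurable_left h.left_nonneg h.integrable_left
    h.measurable_right h.right_nonneg η hA

instance isFiniteMeasure_kernel (h : Admissible a φ) (η : FinConf d) :
    IsFiniteMeasure (h.kernel η) :=
  ⟨by rw [h.kernel_apply η MeasurableSet.univ]; exact ENNReal.ofReal_lt_top⟩

theorem kernel_real (h : Admissible a φ) (η : FinConf d) {A : Set (FinConf d)}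
    (hA : MeasurableSet A) : (h.kernel η).real A = Omega a φ A η := by
  rw [measureReal_def, h.kernel_apply η hA, ENNReal.toReal_ofReal (Omega_nonneg h.left_nonneg A η)]

theorem measurable_Omega (h : Admissible a φ) {A : Set (FinConf d)} (hA : MeasurableSet A) :
    Measurable (Omega a φ A) := by
  simpa only [h.kernel_real _ hA] using measurable_kernel_real h.kernel hA

/-- An upper bound for the total jump rate of `n`-point configurations. -/
def rateBound (_ : Admissible a φ) (n : ℕ) : ℝ := n * ∫ x, a x

theorem rateBound_nonneg (h : Admissible a φ) (n : ℕ) : 0 ≤ h.rateBound n :=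
  mul_nonneg n.cast_nonneg (integral_nonneg h.left_nonneg)

theorem Omega_univ_le_rateBound (h : Admissible a φ) {n : ℕ} {η : FinConf d}
    (hη : η ∈ level d n) : Omega a φ univ η ≤ h.rateBound n := by
  have := Omega_univ_le h.measurable_left h.left_nonneg h.integrable_left
    h.measurable_right h.right_nonneg η
  rwa [show η.pts.card = n from hη] at this

theorem measurable_levelRate (h : Admissible a φ) (n : ℕ) :
    Measurable ((level d n).indicator (Omega a φ univ)) :=
  (h.measurable_Omega MeasurableSet.univ).indicator (measurableSet_level n)

theorem levelRate_le (h : Admissible a φ) (n : ℕ) (η : FinConf d) :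
    (level d n).indicator (Omega a φ univ) η ≤ h.rateBound n := by
  by_cases hη : η ∈ level d n
  · rw [indicator_of_mem hη]
    exact h.Omega_univ_le_rateBound hη
  · rw [indicator_of_notMem hη]
    exact h.rateBound_nonneg n

/-- The kernel `Ω` on `n`-point configurations, completed to a kernel of constant mass by
a multiple of the identity. -/
def levelKernel (h : Admissible a φ) (n : ℕ) :
    ProbabilityTheory.Kernel (FinConf d) (FinConf d) :=
  open Classical in
  ProbabilityTheory.Kernel.piecewise (measurableSet_level n) h.kernel 0 +
    diracKernel (fun η => h.rateBound n - (level d n).indicator (Omega a φ univ) η)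
      (measurable_const.sub (h.measurable_levelRate n))

instance isFiniteMeasure_levelKernel (h : Admissible a φ) (n : ℕ) (η : FinConf d) :
    IsFiniteMeasure (h.levelKernel n η) := by
  classical
  unfold levelKernel
  rw [add_apply, ProbabilityTheory.Kernel.piecewise_apply]
  split_ifs
  · infer_instance
  · rw [zero_apply]
    infer_instance

theorem levelKernel_real (h : Admissible a φ) (n : ℕ) (η : FinConf d) {A : Set (FinConf d)}
    (hA : MeasurableSet A) :
    (h.levelKernel n η).real A = (level d n).indicator (Omega a φ A) η +
      (h.rateBound n - (level d n).indicator (Omega a φ univ) η) *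
        A.indicator (fun _ => (1 : ℝ)) η := by
  classical
  have h1 := diracKernel_real
    (c := fun η => h.rateBound n - (level d n).indicator (Omega a φ univ) η)
    (measurable_const.sub (h.measurable_levelRate n))
    (fun η => sub_nonneg.2 (h.levelRate_le n η)) η hA
  unfold levelKernel
  rw [add_apply, ProbabilityTheory.Kernel.piecewise_apply]
  by_cases hη : η ∈ level d n
  · rw [if_pos hη, measureReal_add_apply, h1, h.kernel_real η hA]
    simp [hη]
  · rw [if_neg hη, zero_apply, zero_add, h1]
    simp [hη]

theorem levelKernel_mass (h : Admissible a φ) (n : ℕ) (η : FinConf d) :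
    (h.levelKernel n η).real univ = h.rateBound n := by
  rw [h.levelKernel_real n η MeasurableSet.univ]
  simp

/-- The part of `L*` acting on measures on `n`-point configurations. -/
def levelOp (h : Admissible a φ) (n : ℕ) :
    SignedMeasure (FinConf d) →L[ℝ] SignedMeasure (FinConf d) :=
  kernelCLM (h.levelKernel_mass n) - h.rateBound n • 1

end Admissible

/-- The value at `η` of the generator applied to the indicator function of `A`. -/
def genIndicator (a φ : EuclideanSpace ℝ (Fin d) → ℝ) (A : Set (FinConf d)) (η : FinConf d) : ℝ :=
  Omega a φ A η - Omega a φ univ η * A.indicator (fun _ => (1 : ℝ)) η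

/-! ### The operator `L*`, its level components and its closure -/

namespace Admissible

variable {a φ : EuclideanSpace ℝ (Fin d) → ℝ}

theorem genIndicator_inter_level (h : Admissible a φ) (A : Set (FinConf d)) (n : ℕ)
    (η : FinConf d) :
    genIndicator a φ (A ∩ level d n) η = (level d n).indicator (genIndicator a φ A) η := by
  unfold genIndicator
  rw [Omega_inter_level h.dim_pos]
  by_cases hη : η ∈ level d n
  · by_cases hA : η ∈ A <;> simp [hη, hA]
  · simp [hη]

theorem integrable_indicator_one (μ : SignedMeasure (FinConf d)) {A : Set (FinConf d)}
    (hA : MeasurableSet A) : μ.Integrable (A.indicator fun _ => (1 : ℝ)) :=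
  (integrable_const (1 : ℝ)).indicator hA

/-- The constant diagonal mass added to the kernel cancels against the subtracted multiple of the
identity. Off level `n` nothing remains. -/
theorem levelOp_apply (h : Admissible a φ) (n : ℕ) (μ : SignedMeasure (FinConf d))
    {A : Set (FinConf d)} (hA : MeasurableSet A) :
    h.levelOp n μ A = ∫ᵛ η, (level d n).indicator (genIndicator a φ A) η ∂•μ := by
  have h1 : (h.levelOp n μ) A =
      kernelCLM (h.levelKernel_mass n) μ A - h.rateBound n * μ A := rfl
  have h2 : μ A = ∫ᵛ η, A.indicator (fun _ => (1 : ℝ)) η ∂•μ := by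
    rw [VectorMeasure.integral_indicator_const _ hA]
    simp
  have h3 := integrable_kernel_real (h.levelKernel n)
    (integrable_kernel_of_mass (h.levelKernel_mass n) μ) hA
  rw [h1, kernelCLM_apply _ μ hA, h2, ← smul_eq_mul, ← VectorMeasure.integral_fun_smul,
    ← VectorMeasure.integral_fun_sub h3 ((integrable_indicator_one μ hA).fun_smul _)]
  congr 1
  funext η
  rw [h.levelKernel_real n η hA]
  unfold genIndicator
  by_cases hη : η ∈ level d n
  · simp only [indicator_of_mem hη, smul_eq_mul]
    ring
  · simp [indicator_of_notMem hη]

theorem isGeneratorSum (h : Admissible a φ) :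
    IsGeneratorSum (fun n => restrictCLM (level d n)) h.levelOp where
  proj_ne m n μ hmn := by
    rw [restrictCLM_apply, restrictCLM_apply,
      VectorMeasure.restrict_restrict _ (measurableSet_level m) (measurableSet_level n),
      (pairwise_disjoint_level hmn).inter_eq, VectorMeasure.restrict_empty]
  hasSum_proj := hasSum_restrict measurableSet_level pairwise_disjoint_level iUnion_level
  hasSum_norm := hasSum_norm_restrict measurableSet_level pairwise_disjoint_level iUnion_level
  op_proj n μ := by
    ext A hA
    rw [h.levelOp_apply n _ hA, h.levelOp_apply n _ hA, restrictCLM_apply,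
      ← VectorMeasure.integral_indicator (measurableSet_level n), indicator_indicator, inter_self]
  proj_op n μ := by
    ext A hA
    rw [restrictCLM_apply, VectorMeasure.restrict_apply _ (measurableSet_level n) hA,
      h.levelOp_apply n _ hA, h.levelOp_apply n _ (hA.inter (measurableSet_level n))]
    congr 1
    rw [show genIndicator a φ (A ∩ level d n) = _ from funext (h.genIndicator_inter_level A n),
      indicator_indicator, inter_self]
  norm_exp_le n t ht :=
    norm_exp_smul_sub_smul_one_le (norm_kernelCLM_le _ (h.rateBound_nonneg n)) ht

/-- On the domain the gain and loss terms are separately integrable, both being dominated by `Ω(Γ₀,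
·)`, so they may be merged. -/
theorem mem_graphLstar_iff (h : Admissible a φ) {μ ν : SignedMeasure (FinConf d)} :
    (μ, ν) ∈ graphLstar a φ ↔ μ ∈ domLstar a φ ∧ ∀ A, MeasurableSet A →
      ν A = ∫ᵛ η, genIndicator a φ A η ∂•μ := by
  refine and_congr_right fun hμ => forall₂_congr fun A hA => ?_
  have h1 : μ.Integrable (Omega a φ univ) := hμ
  have h2 : μ.Integrable (Omega a φ A) := by
    have := integrable_kernel_real h.kernel (μ := μ)
      (by simpa only [h.kernel_real _ MeasurableSet.univ] using h1) hA
    simpa only [h.kernel_real _ hA] using this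
  have h3 : μ.Integrable fun η => Omega a φ univ η * A.indicator (fun _ => (1 : ℝ)) η := by
    refine (h1.indicator hA).congr (Eventually.of_forall fun η => ?_)
    by_cases hη : η ∈ A <;> simp [hη]
  unfold genIndicator
  rw [VectorMeasure.integral_fun_sub h2 h3, neg_add_eq_sub]

theorem exists_mem_graphLstar (h : Admissible a φ) {μ : SignedMeasure (FinConf d)}
    (hμ : μ ∈ domLstar a φ) : ∃ ν, (μ, ν) ∈ graphLstar a φ := by
  have h1 : μ.Integrable fun η => (h.kernel η).real univ := by
    simp only [h.kernel_real _ MeasurableSet.univ]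
    exact hμ
  have hm := h.measurable_Omega MeasurableSet.univ
  have h2 : μ.Integrable fun η => (diracKernel _ hm η).real univ := by
    simp only [diracKernel_real hm (Omega_nonneg h.left_nonneg univ) _ MeasurableSet.univ,
      indicator_univ, mul_one]
    exact hμ
  refine ⟨kernelMeasure h.kernel μ h1 - kernelMeasure (diracKernel _ hm) μ h2, hμ,
    fun A hA => ?_⟩
  rw [sub_apply, kernelMeasure_apply _ _ hA, kernelMeasure_apply _ _ hA, neg_add_eq_sub]
  simp only [h.kernel_real _ hA, diracKernel_real hm (Omega_nonneg h.left_nonneg univ) _ hA]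

theorem existsUnique_mem_graphLstar (h : Admissible a φ) {μ : SignedMeasure (FinConf d)}
    (hμ : μ ∈ domLstar a φ) : ∃! ν, (μ, ν) ∈ graphLstar a φ := by
  obtain ⟨ν, hν⟩ := h.exists_mem_graphLstar hμ
  exact ⟨ν, hν, fun ν' hν' => VectorMeasure.ext fun A hA => (hν'.2 A hA).trans (hν.2 A hA).symm⟩

theorem graphLstar_subset (h : Admissible a φ) :
    graphLstar a φ ⊆ sumGraph (fun n => restrictCLM (level d n)) h.levelOp := by
  rintro ⟨μ, ν⟩ hν n
  ext A hA
  show h.levelOp n μ A = ν.restrict (level d n) A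
  rw [VectorMeasure.restrict_apply _ (measurableSet_level n) hA, h.levelOp_apply n _ hA,
    (h.mem_graphLstar_iff.1 hν).2 _ (hA.inter (measurableSet_level n)),
    show genIndicator a φ (A ∩ level d n) = _ from funext (h.genIndicator_inter_level A n)]

theorem restrict_level_mem_domLstar (h : Admissible a φ) (n : ℕ) (μ : SignedMeasure (FinConf d)) :
    μ.restrict (level d n) ∈ domLstar a φ := by
  show Integrable _ (μ.restrict (level d n)).variation
  rw [VectorMeasure.variation_restrict (measurableSet_level n)]
  refine Integrable.mono' (integrable_const (h.rateBound n))
    (h.measurable_Omega MeasurableSet.univ).aestronglyMeasurable ?_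
  filter_upwards [ae_restrict_mem (measurableSet_level n)] with η hη
  rw [Real.norm_of_nonneg (Omega_nonneg h.left_nonneg _ _)]
  exact h.Omega_univ_le_rateBound hη

/-- The finite sums of level components form a core: jump rates are bounded on each level, and
truncating both entries of a pair approximates it in the graph norm. -/
theorem closure_graphLstar (h : Admissible a φ) :
    closure (graphLstar a φ) = sumGraph (fun n => restrictCLM (level d n)) h.levelOp := by
  refine Subset.antisymm
    (closure_minimal h.graphLstar_subset (IsGeneratorSum.isClosed_sumGraph _ _)) ?_
  rintro ⟨μ, ν⟩ hν
  have hS := h.isGeneratorSum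
  have ht : Tendsto (fun N => (∑ n ∈ Finset.range N, μ.restrict (level d n),
      ∑ n ∈ Finset.range N, ν.restrict (level d n))) atTop (𝓝 (μ, ν)) :=
    (hS.hasSum_proj μ).tendsto_sum_nat.prodMk_nhds (hS.hasSum_proj ν).tendsto_sum_nat
  refine mem_closure_of_tendsto ht (Eventually.of_forall fun N => ?_)
  have hdom : ∑ n ∈ Finset.range N, μ.restrict (level d n) ∈ domLstar a φ :=
    VectorMeasure.Integrable.finsetSum_vectorMeasure
      fun n _ => h.restrict_level_mem_domLstar n μ
  obtain ⟨ν', hν'⟩ := h.exists_mem_graphLstar hdom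
  have hmem : (∑ n ∈ Finset.range N, μ.restrict (level d n),
      ∑ n ∈ Finset.range N, ν.restrict (level d n)) ∈
      sumGraph (fun n => restrictCLM (level d n)) h.levelOp := by
    intro n
    simp only [map_sum]
    refine Finset.sum_congr rfl fun m _ => ?_
    show h.levelOp n (restrictCLM (level d m) μ)
      = restrictCLM (level d n) (restrictCLM (level d m) ν)
    by_cases hmn : n = m
    · subst hmn
      exact (hS.op_proj n μ).trans ((hν n).trans (hS.proj_self n ν).symm)
    · have h1 := hS.op_proj n (restrictCLM (level d m) μ)
      rw [hS.proj_ne n m μ hmn, map_zero] at h1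
      rw [← h1, hS.proj_ne n m ν hmn]
  -- The truncated pair and the pair given by `L*` both lie in the larger graph with the same first
  -- entry, so their second entries agree.
  rw [hS.sumGraph_unique hmem (h.graphLstar_subset hν')]
  exact hν'

/-! ### The stochastic semigroup -/

/-- The semigroup generated by the closure of `L*`. -/
def semigroup (h : Admissible a φ) :
    ℝ≥0 → SignedMeasure (FinConf d) →L[ℝ] SignedMeasure (FinConf d) :=
  h.isGeneratorSum.semigroup

theorem semigroup_nonneg (h : Admissible a φ) (t : ℝ≥0) {μ : SignedMeasure (FinConf d)}
    (hμ : 0 ≤ μ) : 0 ≤ h.semigroup t μ :=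
  nonneg_of_hasSum (h.isGeneratorSum.hasSum_semigroup t μ) fun n =>
    exp_kernel_nonneg (h.levelKernel_mass n) t.2 <| nonneg_iff.2 fun A hA => by
      rw [restrictCLM_apply, VectorMeasure.restrict_apply _ (measurableSet_level n) hA]
      exact nonneg_iff.1 hμ _ (hA.inter (measurableSet_level n))

theorem semigroup_apply_level (h : Admissible a φ) (t : ℝ≥0) (μ : SignedMeasure (FinConf d))
    (n : ℕ) : h.semigroup t μ (level d n) = μ (level d n) := by
  rw [← VectorMeasure.restrict_apply_univ, ← VectorMeasure.restrict_apply_univ (v := μ)]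
  have h1 := h.isGeneratorSum.proj_semigroup t n μ
  rw [restrictCLM_apply, restrictCLM_apply] at h1
  show (h.isGeneratorSum.semigroup t μ).restrict (level d n) univ = _
  rw [h1]
  exact exp_kernel_apply_univ (h.levelKernel_mass n) t _

theorem semigroup_apply_univ (h : Admissible a φ) (t : ℝ≥0) (μ : SignedMeasure (FinConf d)) :
    h.semigroup t μ univ = μ univ := by
  have h1 := fun ν : SignedMeasure (FinConf d) =>
    ν.m_iUnion (measurableSet_level (d := d)) pairwise_disjoint_level
  simp only [iUnion_level] at h1
  exact (h1 _).unique (by simpa only [h.semigroup_apply_level] using h1 μ)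

theorem isStochasticSemigroup (h : Admissible a φ) : IsStochasticSemigroup h.semigroup where
  toIsC0Semigroup := h.isGeneratorSum.isC0Semigroup
  nonneg t _ hμ := h.semigroup_nonneg t hμ
  norm_eq_one t μ hμ h1 := by
    rw [norm_eq_apply_univ_of_nonneg (h.semigroup_nonneg t hμ), h.semigroup_apply_univ,
      ← norm_eq_apply_univ_of_nonneg hμ, h1]

/-- The mass of every level is conserved, so the image measure under `|η|` does not change, and
integrability of `δ(|η|)` depends on that image only. -/
theorem semigroup_mem_coneMb (h : Admissible a φ) (δ : ℕ → ℝ≥0) (t : ℝ≥0)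
    {μ : SignedMeasure (FinConf d)}
    (hμ : μ ∈ coneMb fun η : FinConf d => (δ η.pts.card : ℝ)) :
    h.semigroup t μ ∈ coneMb fun η : FinConf d => (δ η.pts.card : ℝ) := by
  obtain ⟨h0, hi⟩ := hμ
  have h0' := h.semigroup_nonneg t h0
  refine ⟨h0', ?_⟩
  have hlev := h.semigroup_apply_level t μ
  obtain ⟨m, _, rfl⟩ := exists_eq_toSignedMeasure h0
  obtain ⟨m', _, hm'⟩ := exists_eq_toSignedMeasure h0'
  rw [hm'] at hlev ⊢
  have hδ : ∀ (ρ : Measure ℕ), AEStronglyMeasurable (fun n => (δ n : ℝ)) ρ := fun ρ =>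
    (measurable_of_countable _).aestronglyMeasurable
  have hmap : m'.map (fun η : FinConf d => η.pts.card) =
      m.map (fun η : FinConf d => η.pts.card) := by
    refine Measure.ext_of_singleton fun n => ?_
    rw [Measure.map_apply measurable_card (measurableSet_singleton n),
      Measure.map_apply measurable_card (measurableSet_singleton n)]
    have h1 := hlev n
    rw [Measure.toSignedMeasure_apply_measurable (measurableSet_level n),
      Measure.toSignedMeasure_apply_measurable (measurableSet_level n)] at h1
    exact (ENNReal.toReal_eq_toReal_iff' (measure_ne_top _ _) (measure_ne_top _ _)).1 h1
  unfold VectorMeasure.Integrable at hi ⊢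
  rw [Measure.variation_toSignedMeasure] at hi ⊢
  have h2 := (integrable_map_measure (hδ _) measurable_card.aemeasurable).2 hi
  rw [← hmap] at h2
  exact (integrable_map_measure (hδ _) measurable_card.aemeasurable).1 h2

theorem coneMb_subset_domLstar (h : Admissible a φ) {b : FinConf d → ℝ} {ε : ℝ} (hε : 0 < ε)
    (hb : ∀ η, ε * Omega a φ univ η ≤ b η) : coneMb b ⊆ domLstar a φ := by
  intro μ hμ
  refine Integrable.mono' (Integrable.const_mul hμ.2 ε⁻¹)
    (h.measurable_Omega MeasurableSet.univ).aestronglyMeasurable (Eventually.of_forall fun η => ?_)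
  rw [Real.norm_of_nonneg (Omega_nonneg h.left_nonneg _ _)]
  rw [inv_mul_eq_div, le_div_iff₀' hε]
  exact hb η

/-- The orbit stays in the invariant cone, hence in `Dom(L*)`, where the closure takes the same
value as `L*` since its graph is single-valued. -/
theorem isClassicalSolution_graphLstar (h : Admissible a φ) (δ : ℕ → ℝ≥0) {ε : ℝ} (hε : 0 < ε)
    (hδ : ∀ η : FinConf d, ε * Omega a φ univ η ≤ δ η.pts.card)
    {μ : SignedMeasure (FinConf d)}
    (hμ : μ ∈ coneMb fun η : FinConf d => (δ η.pts.card : ℝ)) :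
    IsClassicalSolution (graphLstar a φ) μ fun t => h.semigroup t.toNNReal μ := by
  have hS := h.isGeneratorSum
  have hex : ∀ t : ℝ, ∃ ν, (h.semigroup t.toNNReal μ, ν) ∈ graphLstar a φ := fun t =>
    h.exists_mem_graphLstar
      (h.coneMb_subset_domLstar hε hδ (h.semigroup_mem_coneMb δ t.toNNReal hμ))
  obtain ⟨w, hw⟩ := h.exists_mem_graphLstar (h.coneMb_subset_domLstar hε hδ hμ)
  have hc := hS.isClassicalSolution (h.graphLstar_subset hw)
  refine ⟨hc.initial, hc.continuousOn, hc.differentiableAt, hc.continuousOn_deriv,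
    fun t _ => hex t, fun t ht => ?_⟩
  obtain ⟨ν, hν⟩ := hex t
  have h1 := hS.sumGraph_unique (hc.equation t ht) (h.graphLstar_subset hν)
  exact h1 ▸ hν

end Admissible

end Generator

end Kawasaki

end

/-! ### Well-posedness of the Fokker–Planck equation -/

theorem theorem3p3 (d : ℕ) (hd : 0 < d) (a φ : EuclideanSpace ℝ (Fin d) → ℝ)
    (ha_meas : Measurable a) (ha_nonneg : ∀ x, 0 ≤ a x) (ha_symm : ∀ x, a (-x) = a x)
    (ha_int : Integrable a)
    (hφ_meas : Measurable φ) (hφ_nonneg : ∀ x, 0 ≤ φ x) (hφ_symm : ∀ x, φ (-x) = φ x)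
    (hφ_int : Integrable (fun x => 1 - Real.exp (-φ x))) :
    -- `L*` is an operator with the given domain
    (∀ μ ∈ Kawasaki.domLstar a φ, ∃! ν, (μ, ν) ∈ Kawasaki.graphLstar a φ) ∧
    -- the closure of `L*` generates a stochastic semigroup `S`
    ∃ S : ℝ≥0 → SignedMeasure (Kawasaki.FinConf d) →L[ℝ] SignedMeasure (Kawasaki.FinConf d),
      Kawasaki.IsStochasticSemigroup S ∧
      Kawasaki.generatorGraph S = closure (Kawasaki.graphLstar a φ) ∧
      -- well-posedness of the Fokker-Planck equation for all states on `Γ₀`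
      (∀ (P : Measure (Kawasaki.FinConf d)) [IsProbabilityMeasure P],
        (∀ t, 0 ≤ S t P.toSignedMeasure ∧ S t P.toSignedMeasure univ = 1) ∧
        Kawasaki.IsMildSolution (closure (Kawasaki.graphLstar a φ)) P.toSignedMeasure
          (fun t => S t.toNNReal P.toSignedMeasure) ∧
        (∀ u, Kawasaki.IsMildSolution (closure (Kawasaki.graphLstar a φ)) P.toSignedMeasure u →
          ∀ t : ℝ≥0, u t = S t P.toSignedMeasure) ∧
        ((∃ ν, (P.toSignedMeasure, ν) ∈ closure (Kawasaki.graphLstar a φ)) →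
          Kawasaki.IsClassicalSolution (closure (Kawasaki.graphLstar a φ)) P.toSignedMeasure
            (fun t => S t.toNNReal P.toSignedMeasure)) ∧
        (∀ u, Kawasaki.IsClassicalSolution (closure (Kawasaki.graphLstar a φ))
            P.toSignedMeasure u →
          ∀ t : ℝ≥0, u t = S t P.toSignedMeasure)) ∧
      -- the cones `M_{b,+}`, where `b(η) = δ(|η|) ≥ ε Ω(Γ₀, η)`
      (∀ (δ : ℕ → ℝ≥0) (ε : ℝ), 0 < ε →
        (∀ η : Kawasaki.FinConf d, ε * Kawasaki.Omega a φ univ η ≤ δ η.pts.card) →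
        (∀ t, ∀ μ ∈ Kawasaki.coneMb (fun η : Kawasaki.FinConf d => (δ η.pts.card : ℝ)),
          S t μ ∈ Kawasaki.coneMb (fun η : Kawasaki.FinConf d => (δ η.pts.card : ℝ))) ∧
        (∀ (P : Measure (Kawasaki.FinConf d)) [IsProbabilityMeasure P],
          P.toSignedMeasure ∈
            Kawasaki.coneMb (fun η : Kawasaki.FinConf d => (δ η.pts.card : ℝ)) →
          Kawasaki.IsClassicalSolution (Kawasaki.graphLstar a φ) P.toSignedMeasure
            (fun t => S t.toNNReal P.toSignedMeasure))) := by
  have h : Kawasaki.Admissible a φ :=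
    ⟨hd, ha_meas, ha_nonneg, ha_int, hφ_meas, hφ_nonneg⟩
  have hS := h.isGeneratorSum
  refine ⟨fun μ hμ => h.existsUnique_mem_graphLstar hμ, h.semigroup, h.isStochasticSemigroup, ?_⟩
  rw [h.closure_graphLstar]
  refine ⟨hS.generatorGraph_semigroup, fun P hP => ⟨fun t => ?_, hS.isMildSolution _,
    fun u hu => hS.eq_semigroup_of_isMildSolution hu, fun ⟨ν, hν⟩ => hS.isClassicalSolution hν,
    fun u hu => hS.eq_semigroup_of_isClassicalSolution hu⟩,
    fun δ ε hε hδ => ⟨fun t μ hμ => h.semigroup_mem_coneMb δ t hμ,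
      fun P hP hμ => h.isClassicalSolution_graphLstar δ hε hδ hμ⟩⟩
  refine ⟨h.semigroup_nonneg t (Kawasaki.nonneg_iff.2 fun A hA => ?_), ?_⟩
  · rw [Measure.toSignedMeasure_apply_measurable hA]
    exact measureReal_nonneg
  · rw [h.semigroup_apply_univ, Measure.toSignedMeasure_apply_measurable MeasurableSet.univ]
    simp
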